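/- Let $S$ and $\Sigma$ be compact metrizable spaces. Let $\Sigma$ be a topological semigroup (the product is associative and jointly continuous) which acts on $S$ by a jointly continuous map $(\sigma,x)\mapsto\sigma x$ with $\sigma_1(\sigma_2x)=(\sigma_1\sigma_2)x$. Let $\mu=(\mu_k)_{k\in-\mathbb N}$ be a family of Borel probability measures on $\Sigma$, where $-\mathbb N=\{0,-1,-2,\dots\}$. A *solution* (of Tsirelson's equation with noise law $\mu$) is a pair of processes $X=(X_k)_{k\in-\mathbb N}$ in $S$ and $N=(N_k)_{k\in-\mathbb N}$ in $\Sigma$, defined on some common probability space, such that for every $k\in-\mathbb N$: $X_k=N_kX_{k-1}$ a.s.; $N_k$ is independent of $\sigma(X_j,N_j: j\le k-1)$; and $N_k$ has law $\mu_k$. A solution is *strong* if for every $k\in-\mathbb N$ there is a measurable $f_k:\Sigma^{-\mathbb N}\to S$ with $X_k=f_k(N_k,N_{k-1},\dots)$ a.s. It is *extremal* if its law on $S^{-\mathbb N}\times\Sigma^{-\mathbb N}$ is an extreme point of the convex set of the laws of all solutions with noise law $\mu$. Let $N=(N_k)_{k\in-\mathbb N}$ be independent random variables such that $N_k$ has law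 $\mu_k$ and write $N_{k,l}=N_kN_{k-1}\cdots N_{l+1}$ for $k>l$. Suppose that the following condition holds. **(P2$'$)** $H$ is a compact non-trivial subgroup of $\Sigma$ (a compact subsemigroup with at least two elements which is a group under the product of $\Sigma$) such that, for every $k\in-\mathbb N$, the random variable $N_{k,l}$ converges in law as $l\to-\infty$ to a law that is invariant under right multiplication by every element of $H$, and $N_{k,l}H$ converges a.s. as $l\to-\infty$ in the space $\Sigma/H$ of all cosets $\sigma H=\{\sigma h:h\in H\}$, $\sigma\in\Sigma$, equipped with the quotient topology of the map $\sigma\mapsto\sigma H$. Suppose, moreover, that $\Sigma$ is left-cancellative (if $\sigma\sigma_1=\sigma\sigma_2$ then $\sigma_1=\sigma_2$) and that every element of $\Sigma$ acts cancellatively on $S$ (if $\sigma x=\sigma y$ then $x=y$). For $x\in S$ write $Hx=\{hx:h\in H\}$. Then: (i) $Hx$ is a singleton for every $x\in S$ if and only if all extremal solutions are strong. (ii) $Hx$ is a singleton for no $x\in S$ if and only if all extremal solutions are non-strong. (iii) (Answer to the question (Q2), whether under (P2$'$) all solutions are non-strong.) $Hx$ is a singleton for no $x\in S$ if and only if all solutions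 are non-strong. -/

import Mathlib

open Filter MeasureTheory ProbabilityTheory Topology
open scoped NNReal

universe w

/-!
The time axis `-ℕ = {0, -1, -2, …}` is indexed by `ℕ`: the index `k : ℕ` stands for the time `-k`.
So `X (k + 1)` is the state one step *before* `X k`, and `k → ∞` means going to the remote past.
Throughout, `S` is the state space and `T` is the semigroup (written `Σ` in mathematical text).
-/

section Tsirelson

variable {S T Ω : Type*}

/-- The `σ`-field generated by `(X_j, N_j)` for all times up to and including `-k`. -/
@[reducible]
def pastField [MeasurableSpace S] [MeasurableSpace T]
    (X : ℕ → Ω → S) (N : ℕ → Ω → T) (k : ℕ) : MeasurableSpace Ω :=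
  ⨆ j : ℕ, ⨆ _ : k ≤ j, (MeasurableSpace.comap (X j) inferInstance ⊔
    MeasurableSpace.comap (N j) inferInstance)

/-- `(X, N)`, defined on the probability space `(Ω, P)`, is a solution of Tsirelson's equation with
noise law `μ`. -/
structure IsSolution [MeasurableSpace S] [MeasurableSpace T] [SMul T S] [MeasurableSpace Ω]
    (μ : ℕ → Measure T) (P : Measure Ω) (X : ℕ → Ω → S) (N : ℕ → Ω → T) : Prop where
  measurable_state : ∀ k, Measurable (X k)
  measurable_noise : ∀ k, Measurable (N k)
  equation : ∀ k, ∀ᵐ ω ∂P, X k ω = N k ω • X (k + 1) ω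
  indep_past : ∀ k, Indep (MeasurableSpace.comap (N k) inferInstance) (pastField X N (k + 1)) P
  law_noise : ∀ k, P.map (N k) = μ k

/-- The solution `(X, N)` is strong: each state is almost surely a measurable function of the
present and past noise. -/
def IsStrong [MeasurableSpace S] [MeasurableSpace T] [MeasurableSpace Ω]
    (P : Measure Ω) (X : ℕ → Ω → S) (N : ℕ → Ω → T) : Prop :=
  ∀ k, ∃ f : (ℕ → T) → S, Measurable f ∧ ∀ᵐ ω ∂P, X k ω = f (fun j => N (k + j) ω)

/-- The set of the laws on `S^{-ℕ} × Σ^{-ℕ}` of all solutions with noise law `μ`: those probability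
measures under which the coordinate process is a solution. -/
def solutionLaws (S : Type*) {T : Type*} [MeasurableSpace S] [MeasurableSpace T] [SMul T S]
    (μ : ℕ → Measure T) : Set (Measure ((ℕ → S) × (ℕ → T))) :=
  {L | IsProbabilityMeasure L ∧ IsSolution μ L (fun k p => p.1 k) (fun k p => p.2 k)}

/-- The law of `(X, N)` is an extreme point of the convex set of all laws of solutions. -/
def IsExtremal [MeasurableSpace S] [MeasurableSpace T] [SMul T S] [MeasurableSpace Ω]
    (μ : ℕ → Measure T) (P : Measure Ω) (X : ℕ → Ω → S) (N : ℕ → Ω → T) : Prop :=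
  P.map (fun ω => ((fun k => X k ω), (fun k => N k ω))) ∈
    Set.extremePoints ℝ≥0 (solutionLaws S μ)

/-- `N` is a noise process with law `μ`: independent variables, the `k`-th one having law `μ k`. -/
structure IsNoise [MeasurableSpace T] [MeasurableSpace Ω]
    (μ : ℕ → Measure T) (P : Measure Ω) (N : ℕ → Ω → T) : Prop where
  measurable_noise : ∀ k, Measurable (N k)
  indep : iIndepFun N P
  law_noise : ∀ k, P.map (N k) = μ k

/-- `noiseProd N k n` is the product `N_k N_{k-1} ⋯ N_{l+1}` of the `n + 1` noise variables at the
times `-k, -(k + 1), …, -(k + n)`, in this order. -/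
def noiseProd [Mul T] (N : ℕ → Ω → T) (k : ℕ) : ℕ → Ω → T
  | 0 => fun ω => N k ω
  | n + 1 => fun ω => noiseProd N k n ω * N (k + (n + 1)) ω

/-- The subsemigroup `H` is a group for the multiplication of `T`. Its identity `e` need not be an
identity of `T`. -/
def IsSubgroupOf [Mul T] (H : Subsemigroup T) : Prop :=
  ∃ e ∈ H, ∀ h ∈ H, e * h = h ∧ h * e = h ∧ ∃ h' ∈ H, h * h' = e ∧ h' * h = e

/-- Two elements `σ`, `τ` are identified when their cosets `σ H` and `τ H` are the same set. -/
def cosetSetoid [Mul T] (H : Subsemigroup T) : Setoid T :=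
  Setoid.ker (fun σ : T => (fun h : T => σ * h) '' (H : Set T))

/-- The space `T / H` of the cosets `σ H`, with the quotient topology. -/
abbrev CosetSpace [Mul T] (H : Subsemigroup T) : Type _ := Quotient (cosetSetoid H)

/-- The coset `σ H` as a point of `T / H`. -/
def toCoset [Mul T] (H : Subsemigroup T) (σ : T) : CosetSpace H := Quotient.mk (cosetSetoid H) σ

/-- `H` is a compact non-trivial subgroup of `T` and, as the product `N_k N_{k-1} ⋯ N_{l+1}` is
extended into the remote past, it converges in law to a right `H`-invariant law, while its coset
converges almost surely in `T / H`. -/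
structure SatisfiesP2 [Mul T] [TopologicalSpace T] [MeasurableSpace T] [OpensMeasurableSpace T]
    [MeasurableSpace Ω] (P : Measure Ω) [IsProbabilityMeasure P] (N : ℕ → Ω → T)
    (H : Subsemigroup T) : Prop where
  isSubgroup : IsSubgroupOf H
  isCompact : IsCompact (H : Set T)
  nontrivial : (H : Set T).Nontrivial
  tendsto_law : ∀ k, ∃ ν : ProbabilityMeasure T,
    (∀ h ∈ H, (ν : Measure T).map (fun σ => σ * h) = ν) ∧
    TendstoInDistribution (fun n => noiseProd N k n) atTop (id : T → T) (fun _ => P) (ν : Measure T)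
  tendsto_coset : ∀ k, ∀ᵐ ω ∂P, ∃ c : CosetSpace H,
    Tendsto (fun n => toCoset H (noiseProd N k n ω)) atTop (𝓝 c)

/-- `Hx = {h x : h ∈ H}` is a singleton. -/
def OrbitIsSingleton [Mul T] [SMul T S] (H : Subsemigroup T) (x : S) : Prop :=
  ∃ y : S, (fun h : T => h • x) '' (H : Set T) = {y}

end Tsirelson

set_option linter.unusedSectionVars false

/-! Extremal solutions correspond to the `H`-orbits in `S`, the orbit being what the states approach
in the remote past.

Along a solution X_0 = N_{0,l} X_l, and all limit points of N_{0,l} have the same coset. If (σ, y)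
and (τ, z) are limit points of (N_{0,l}, X_l), then σy = τz while σ acts as τg for some g in `H`, so
z = gy by cancellation: the limit points of the states lie in a single orbit
(`CosetStable.exists_asympOrbit`). This orbit is a tail quantity, hence deterministic for an
extremal law (`exists_asympOrbit_of_mem_extremePoints`). Conversely, a deterministic orbit Hx
determines the law: by right `H`-invariance of the limit ν of N_{k,l}, the law of X_k must be that
of σx with σ distributed as ν (`IsSolution.map_eq_of_asympOrbit`). So such a solution is extremal.
Every orbit occurs, through a weak limit of processes started from x in the remote past
(`exists_solutionLaw_asympOrbit`).

It remains to see that the solution attached to Hx is strong exactly when `H` fixes x. If it does,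
X_k is the limit of N_{k,l} x (`isStrong_of_asympOrbit`). If hx ≠ x, existence for the diagonal
action on S × S at (x, hx) gives two solutions with the same law and the same noise; strength would
make them equal, although they approach H(x, hx), which misses the diagonal
(`not_isStrong_of_asympOrbit`). Statements (i) and (ii) follow, and (iii) as well because strong
solutions are extremal (`mem_extremePoints_of_isStrong`). -/

/-- The images `{a h y : h ∈ K}` under a compact family of maps are separated by countably many
continuous functions of `y`. -/
theorem exists_continuousMap_separating_images {Y K : Type*} [TopologicalSpace Y] [CompactSpace Y]
    [TopologicalSpace.MetrizableSpace Y] [TopologicalSpace K] {C : Set K} (hC : IsCompact C)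
    (hne : C.Nonempty) (a : Y → K → Y) (ha : Continuous fun p : Y × K => a p.1 p.2) :
    ∃ Φ : ℕ → C(Y, ℝ), ∀ y y', (∀ n, Φ n y = Φ n y') ↔ a y '' C = a y' '' C := by
  rcases isEmpty_or_nonempty Y with hY | hY
  · exact ⟨fun _ => 0, fun y => hY.elim y⟩
  let := TopologicalSpace.metrizableSpaceMetric Y
  let q := TopologicalSpace.denseSeq Y
  have hcomp : ∀ y, IsCompact (a y '' C) := fun y =>
    hC.image (ha.comp (Continuous.prodMk_right y))
  -- As an infimum over the fixed compact set `C`, the distance is continuous in `y`.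
  have hinf : ∀ p y, Metric.infDist p (a y '' C) = sInf ((fun h => dist p (a y h)) '' C) := by
    intro p y
    rw [Metric.infDist_eq_iInf, sInf_image', ← sInf_range, ← sInf_range]
    congr 1
    ext r
    simp
  have hcont : ∀ p, Continuous fun y => Metric.infDist p (a y '' C) := by
    intro p
    simp_rw [hinf]
    exact hC.continuous_sInf (f := fun y h => dist p (a y h)) (continuous_const.dist ha)
  -- The separating functions are the distances from the points of a dense sequence: a nonempty
  -- compact set is the zero set of its distance function, which is continuous and so known from a
  -- dense set.
  refine ⟨fun n => ⟨_, hcont (q n)⟩, fun y y' => ⟨fun h => ?_, fun h n => ?_⟩⟩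
  · have hd : (fun p => Metric.infDist p (a y '' C)) = fun p => Metric.infDist p (a y' '' C) :=
      Continuous.ext_on (TopologicalSpace.denseRange_denseSeq Y) (Metric.continuous_infDist_pt _)
        (Metric.continuous_infDist_pt _) (by rintro _ ⟨n, rfl⟩; exact h n)
    ext p
    rw [(hcomp y).isClosed.mem_iff_infDist_zero (hne.image _),
      (hcomp y').isClosed.mem_iff_infDist_zero (hne.image _)]
    exact iff_of_eq (congrArg (· = 0) (congrFun hd p))
  · simp only [ContinuousMap.coe_mk, h]

/-! ### Consequences of cancellation for the group `H` and its orbits -/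

section Algebra

variable {S T : Type*} [Semigroup T] {H : Subsemigroup T}

/-- Cancelling e in e(eσ) = eσ shows that the identity of `H`, a priori only an idempotent of `T`,
is a left identity of all of `T`. -/
theorem IsSubgroupOf.exists_left_identity (hH : IsSubgroupOf H)
    (hT : ∀ σ σ₁ σ₂ : T, σ * σ₁ = σ * σ₂ → σ₁ = σ₂) :
    ∃ e ∈ H, (∀ σ : T, e * σ = σ) ∧ (∀ h ∈ H, h * e = h) ∧ ∀ h ∈ H, ∃ h' ∈ H, h' * h = e := by
  obtain ⟨e, he, h⟩ := hH
  refine ⟨e, he, fun σ => hT e _ _ ?_, fun g hg => (h g hg).2.1, fun g hg => ?_⟩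
  · rw [← mul_assoc, (h e he).1]
  · obtain ⟨g', hg', -, h2⟩ := (h g hg).2.2
    exact ⟨g', hg', h2⟩

theorem smul_eq_self_of_left_identity [SemigroupAction T S]
    (hS : ∀ (σ : T) (x y : S), σ • x = σ • y → x = y) {e : T} (he : ∀ σ : T, e * σ = σ) (x : S) :
    e • x = x :=
  hS e _ _ (by rw [← mul_smul, he])

variable [SemigroupAction T S] (hH : IsSubgroupOf H)
  (hT : ∀ σ σ₁ σ₂ : T, σ * σ₁ = σ * σ₂ → σ₁ = σ₂)
  (hS : ∀ (σ : T) (x y : S), σ • x = σ • y → x = y)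
include hH hT hS

theorem mem_orbit_self (x : S) : x ∈ (fun h : T => h • x) '' (H : Set T) := by
  obtain ⟨e, he, h1, -⟩ := hH.exists_left_identity hT
  exact ⟨e, he, smul_eq_self_of_left_identity hS h1 x⟩

omit hS in
theorem orbit_eq_of_mem {x y : S} (hy : y ∈ (fun h : T => h • x) '' (H : Set T)) :
    (fun h : T => h • y) '' (H : Set T) = (fun h : T => h • x) '' (H : Set T) := by
  obtain ⟨e, he, h1, h2, h3⟩ := hH.exists_left_identity hT
  obtain ⟨g, hg, rfl⟩ := hy
  obtain ⟨g', hg', hgg⟩ := h3 g hg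
  ext z
  constructor
  · rintro ⟨h, hh, rfl⟩
    exact ⟨h * g, H.mul_mem hh hg, by simp only [mul_smul]⟩
  · rintro ⟨h, hh, rfl⟩
    refine ⟨h * g', H.mul_mem hh hg', ?_⟩
    simp only [← mul_smul, mul_assoc, hgg, h2 h hh]

theorem orbitIsSingleton_iff (x : S) : OrbitIsSingleton H x ↔ ∀ h ∈ H, h • x = x := by
  have hx := mem_orbit_self hH hT hS x
  constructor
  · rintro ⟨y, hy⟩ h hh
    have h1 : h • x ∈ (fun h : T => h • x) '' (H : Set T) := ⟨h, hh, rfl⟩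
    rw [hy, Set.mem_singleton_iff] at h1 hx
    rw [h1, ← hx]
  · intro h
    refine ⟨x, Set.Subset.antisymm ?_ (Set.singleton_subset_iff.2 hx)⟩
    rintro _ ⟨g, hg, rfl⟩
    exact h g hg

end Algebra

/-! ### Products along a deterministic noise path -/

section PathProd

variable {T Ω : Type*}

/-- The product `t_k t_{k+1} ⋯ t_{k+n}`. -/
abbrev pathProd [Mul T] (t : ℕ → T) (k n : ℕ) : T := noiseProd (fun j (s : ℕ → T) => s j) k n t

theorem noiseProd_eq_pathProd [Mul T] (N : ℕ → Ω → T) (k n : ℕ) (ω : Ω) :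
    noiseProd N k n ω = pathProd (fun j => N j ω) k n := by
  induction n with
  | zero => rfl
  | succ n ih => simp only [pathProd, noiseProd] at ih ⊢; rw [ih]

theorem pathProd_shift [Mul T] (t : ℕ → T) (k n : ℕ) :
    pathProd t k n = pathProd (fun j => t (k + j)) 0 n := by
  induction n with
  | zero => rfl
  | succ n ih => simp only [pathProd, noiseProd, zero_add] at ih ⊢; rw [ih]

theorem pathProd_add [Semigroup T] (t : ℕ → T) (k m n : ℕ) :
    pathProd t k (m + n + 1) = pathProd t k m * pathProd t (k + m + 1) n := by
  induction n with
  | zero => simp only [pathProd, noiseProd]; rfl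
  | succ n ih =>
    have : pathProd t k (m + (n + 1) + 1) =
      pathProd t k (m + n + 1) * t (k + (m + n + 1 + 1)) := rfl
    rw [this, ih, mul_assoc]
    have h2 : pathProd t (k + m + 1) (n + 1) =
      pathProd t (k + m + 1) n * t (k + m + 1 + (n + 1)) := rfl
    rw [h2]
    congr 3
    ring

theorem continuous_pathProd [Mul T] [TopologicalSpace T] [ContinuousMul T] (k n : ℕ) :
    Continuous fun t : ℕ → T => pathProd t k n := by
  induction n with
  | zero => exact continuous_apply k
  | succ n ih => exact ih.mul (continuous_apply _)

theorem eq_pathProd_smul {S : Type*} [Semigroup T] [SemigroupAction T S] {x : ℕ → S} {t : ℕ → T}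
    (h : ∀ k, x k = t k • x (k + 1)) (k n : ℕ) : x k = pathProd t k n • x (k + n + 1) := by
  induction n with
  | zero => exact h k
  | succ n ih =>
    have : pathProd t k (n + 1) = pathProd t k n * t (k + (n + 1)) := rfl
    rw [this, mul_smul, ih, h (k + n + 1)]
    rfl

end PathProd

/-! ### Asymptotic orbits and stable cosets along deterministic paths -/

/-- Every limit point of `u` lies in the orbit `Hx`. -/
def AsympOrbit {S T : Type*} [TopologicalSpace S] [Mul T] [SMul T S] (H : Subsemigroup T) (x : S)
    (u : ℕ → S) : Prop :=
  ∀ U : Ultrafilter ℕ, ↑U ≤ (atTop : Filter ℕ) → ∀ y, Tendsto u U (𝓝 y) →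
    y ∈ (fun h : T => h • x) '' (H : Set T)

/-- All limit points of the products `t_0 t_1 ⋯ t_n` have the same coset. -/
def CosetStable {T : Type*} [TopologicalSpace T] [Mul T] (H : Subsemigroup T) (t : ℕ → T) : Prop :=
  ∀ U V : Ultrafilter ℕ, ↑U ≤ (atTop : Filter ℕ) → ↑V ≤ (atTop : Filter ℕ) → ∀ σ τ : T,
    Tendsto (fun n => pathProd t 0 n) U (𝓝 σ) → Tendsto (fun n => pathProd t 0 n) V (𝓝 τ) →
      (fun h => σ * h) '' (H : Set T) = (fun h => τ * h) '' (H : Set T)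

theorem Ultrafilter.exists_tendsto_of_compactSpace {ι Y : Type*} [TopologicalSpace Y]
    [CompactSpace Y] (U : Ultrafilter ι) (u : ι → Y) : ∃ y, Tendsto u U (𝓝 y) := by
  obtain ⟨y, -, hy⟩ := isCompact_univ.ultrafilter_le_nhds (U.map u) (by simp)
  exact ⟨y, hy⟩

section Asymp

variable {S T : Type*} [TopologicalSpace S] [CompactSpace S] [TopologicalSpace T]

omit [TopologicalSpace T] in
theorem AsympOrbit.tendsto [Mul T] [SMul T S] {H : Subsemigroup T} {x : S} {u : ℕ → S}
    (hu : AsympOrbit H x u) {Z : Type*} [TopologicalSpace Z] {Φ : S → Z} (hΦ : Continuous Φ)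
    (hinv : ∀ y ∈ (fun h : T => h • x) '' (H : Set T), Φ y = Φ x) :
    Tendsto (fun n => Φ (u n)) atTop (𝓝 (Φ x)) := by
  rw [tendsto_iff_ultrafilter]
  intro U hU
  obtain ⟨y, hy⟩ := U.exists_tendsto_of_compactSpace u
  rw [← hinv y (hu U hU y hy)]
  exact (hΦ.tendsto y).comp hy

variable [T2Space S] [Semigroup T] [SemigroupAction T S] {H : Subsemigroup T}
  (hH : IsSubgroupOf H)
  (hT : ∀ σ σ₁ σ₂ : T, σ * σ₁ = σ * σ₂ → σ₁ = σ₂)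
  (hS : ∀ (σ : T) (x y : S), σ • x = σ • y → x = y)

omit [T2Space S] [TopologicalSpace T] in
include hH hT hS in
theorem asympOrbit_iff_tendsto {Φ : ℕ → C(S, ℝ)}
    (hΦ : ∀ y y', (∀ n, Φ n y = Φ n y') ↔
      (fun h : T => h • y) '' (H : Set T) = (fun h : T => h • y') '' (H : Set T))
    {x : S} {u : ℕ → S} :
    AsympOrbit H x u ↔ ∀ i, Tendsto (fun n => Φ i (u n)) atTop (𝓝 (Φ i x)) := by
  constructor
  · intro hu i
    exact hu.tendsto (Φ i).continuous fun y hy =>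
      (hΦ y x).2 (orbit_eq_of_mem hH hT hy) i
  · intro h U hU y hy
    rw [← (hΦ y x).1 fun i => ?_]
    · exact mem_orbit_self hH hT hS y
    · exact tendsto_nhds_unique (((Φ i).continuous.tendsto y).comp hy) ((h i).mono_left hU)

variable [CompactSpace T]

omit [TopologicalSpace S] [CompactSpace S] [T2Space S] [SemigroupAction T S] in
theorem cosetStable_iff_tendsto {Ψ : ℕ → C(T, ℝ)}
    (hΨ : ∀ σ τ, (∀ n, Ψ n σ = Ψ n τ) ↔
      (fun h => σ * h) '' (H : Set T) = (fun h => τ * h) '' (H : Set T)) {t : ℕ → T} :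
    CosetStable H t ↔ ∀ i, ∃ c, Tendsto (fun n => Ψ i (pathProd t 0 n)) atTop (𝓝 c) := by
  constructor
  · intro ht i
    obtain ⟨σ, hσ⟩ := (Ultrafilter.of (atTop : Filter ℕ)).exists_tendsto_of_compactSpace
      fun n => pathProd t 0 n
    refine ⟨Ψ i σ, ?_⟩
    rw [tendsto_iff_ultrafilter]
    intro U hU
    obtain ⟨τ, hτ⟩ := U.exists_tendsto_of_compactSpace fun n => pathProd t 0 n
    rw [← (hΨ τ σ).2 (ht U _ hU (Ultrafilter.of_le _) τ σ hτ hσ) i]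
    exact ((Ψ i).continuous.tendsto τ).comp hτ
  · intro h U V hU hV σ τ hσ hτ
    refine (hΨ σ τ).1 fun i => ?_
    obtain ⟨c, hc⟩ := h i
    rw [tendsto_nhds_unique (((Ψ i).continuous.tendsto σ).comp hσ) (hc.mono_left hU),
      tendsto_nhds_unique (((Ψ i).continuous.tendsto τ).comp hτ) (hc.mono_left hV)]

omit [TopologicalSpace S] [CompactSpace S] [T2Space S] [SemigroupAction T S]
  [CompactSpace T] in
-- A continuous function that is constant on the classes descends to a continuous function on the
-- quotient; no separation property of `T / H` is needed.
theorem tendsto_of_tendsto_toCoset {t : ℕ → T} {c : CosetSpace H}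
    (hc : Tendsto (fun n => toCoset H (pathProd t 0 n)) atTop (𝓝 c)) {Ψ : C(T, ℝ)}
    (hΨ : ∀ σ τ, (fun h => σ * h) '' (H : Set T) = (fun h => τ * h) '' (H : Set T) → Ψ σ = Ψ τ) :
    ∃ r, Tendsto (fun n => Ψ (pathProd t 0 n)) atTop (𝓝 r) := by
  let Ψ' : CosetSpace H → ℝ := Quotient.lift Ψ fun σ τ h => hΨ σ τ h
  have hcont : Continuous Ψ' := Continuous.quotient_lift Ψ.continuous _
  exact ⟨Ψ' c, (hcont.tendsto c).comp hc⟩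

omit [CompactSpace S] [T2Space S] [TopologicalSpace S] [TopologicalSpace T] [CompactSpace T] in
include hH hT hS in
-- The element σe lies in σH = τH, so it equals τg for some g in `H`, and e acts trivially on `S`.
theorem smul_mem_of_coset_eq {σ τ : T}
    (h : (fun h => σ * h) '' (H : Set T) = (fun h => τ * h) '' (H : Set T)) (x : S) :
    ∃ g ∈ H, σ • x = τ • g • x := by
  obtain ⟨e, he, h1, -⟩ := hH.exists_left_identity hT
  have : σ * e ∈ (fun h => σ * h) '' (H : Set T) := ⟨e, he, rfl⟩
  rw [h] at this
  obtain ⟨g, hg, hge⟩ := this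
  refine ⟨g, hg, ?_⟩
  rw [← mul_smul]
  simp only at hge
  rw [hge, mul_smul, smul_eq_self_of_left_identity hS h1]

variable [ContinuousMul T] [ContinuousSMul T S]

omit [ContinuousMul T] in
include hH hT hS in
theorem CosetStable.exists_asympOrbit {t : ℕ → T} (ht : CosetStable H t) {x : ℕ → S}
    (hx : ∀ k, x k = t k • x (k + 1)) : ∃ y, AsympOrbit H y x := by
  let V := Ultrafilter.of (atTop : Filter ℕ)
  have hs : Tendsto (fun n : ℕ => n + 1) atTop atTop := tendsto_add_atTop_nat 1
  have key : ∀ U : Ultrafilter ℕ, ∀ y σ, Tendsto (fun n => x (n + 1)) U (𝓝 y) →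
      Tendsto (fun n => pathProd t 0 n) U (𝓝 σ) → x 0 = σ • y := by
    intro U y σ hy hσ
    have h1 : Tendsto (fun n => pathProd t 0 n • x (n + 1)) U (𝓝 (σ • y)) := hσ.smul hy
    refine tendsto_nhds_unique ?_ h1
    refine tendsto_const_nhds.congr fun n => ?_
    have := eq_pathProd_smul hx 0 n
    rwa [zero_add] at this
  obtain ⟨y, hy⟩ := V.exists_tendsto_of_compactSpace fun n => x (n + 1)
  obtain ⟨σ, hσ⟩ := V.exists_tendsto_of_compactSpace fun n => pathProd t 0 n
  refine ⟨y, fun U hU z hz => ?_⟩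
  -- The product of t_0, …, t_n is paired with the state of index n + 1, whence the shift by one.
  let W : Ultrafilter ℕ := U.map (fun n => n - 1)
  have hW : ↑W ≤ (atTop : Filter ℕ) := (tendsto_sub_atTop_nat 1).mono_left hU
  have hz' : Tendsto (fun n => x (n + 1)) W (𝓝 z) := by
    rw [Ultrafilter.coe_map, tendsto_map'_iff]
    refine hz.congr' ?_
    filter_upwards [hU (eventually_ge_atTop 1)] with n hn
    simp only [Function.comp]
    rw [Nat.sub_add_cancel hn]
  obtain ⟨τ, hτ⟩ := W.exists_tendsto_of_compactSpace fun n => pathProd t 0 n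
  have hst := ht V W (Ultrafilter.of_le _) hW σ τ hσ hτ
  obtain ⟨g, hg, hge⟩ := smul_mem_of_coset_eq hH hT hS hst y
  refine ⟨g, hg, hS τ _ _ ?_⟩
  simp only
  rw [← hge, ← key V y σ hy hσ, key W z τ hz' hτ]

omit [CompactSpace S] in
include hH hT hS in
-- Splitting t_0 ⋯ t_{m+r+1} after t_m gives limit points στ and σ with the same coset, so στx = σgx
-- with g in `H`, and σ cancels. The lengths `r m` are arbitrary because a diagonal choice of
-- starting times will dictate them.
theorem CosetStable.asympOrbit_pathProd {t : ℕ → T} (ht : CosetStable H t) (r : ℕ → ℕ) (x : S) :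
    AsympOrbit H x fun m => pathProd t (m + 1) (r m) • x := by
  intro U hU y hy
  obtain ⟨σ, hσ⟩ := U.exists_tendsto_of_compactSpace fun n => pathProd t 0 n
  obtain ⟨τ, hτ⟩ := U.exists_tendsto_of_compactSpace fun m => pathProd t (m + 1) (r m)
  have hy' : y = τ • x := tendsto_nhds_unique hy (hτ.smul tendsto_const_nhds)
  let V : Ultrafilter ℕ := U.map (fun m => m + r m + 1)
  have hV : ↑V ≤ (atTop : Filter ℕ) := by
    have : Tendsto (fun m => m + r m + 1) atTop atTop :=
      tendsto_atTop_mono (fun m => by simp only [id]; lia) tendsto_id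
    exact this.mono_left hU
  have h1 : Tendsto (fun n => pathProd t 0 n) V (𝓝 (σ * τ)) := by
    rw [Ultrafilter.coe_map, tendsto_map'_iff]
    refine (hσ.mul hτ).congr fun m => ?_
    simp only [Function.comp]
    rw [pathProd_add, zero_add]
  obtain ⟨g, hg, hge⟩ := smul_mem_of_coset_eq hH hT hS (ht V U hV hU _ _ h1 hσ) x
  refine ⟨g, hg, hS σ _ _ ?_⟩
  simp only
  rw [hy', ← hge, mul_smul]

end Asymp

/-! ### Trajectories, independence of the past, and transport of solutions -/

section Past

variable {S S' T Ω Ω' : Type*} [MeasurableSpace S] [MeasurableSpace S'] [MeasurableSpace T]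

/-- The trajectory of `(X, N)` up to and including the time `-k`. -/
def pastMap (X : ℕ → Ω → S) (N : ℕ → Ω → T) (k : ℕ) (ω : Ω) : (ℕ → S) × (ℕ → T) :=
  (fun j => X (k + j) ω, fun j => N (k + j) ω)

/-- This turns independence of `σ`-fields into independence of two random variables, which can then
be pushed through measurable maps and product measures. -/
theorem pastField_eq_comap (X : ℕ → Ω → S) (N : ℕ → Ω → T) (k : ℕ) :
    pastField X N k = MeasurableSpace.comap (pastMap X N k) inferInstance := by
  apply le_antisymm
  · refine iSup₂_le fun j hj => sup_le ?_ ?_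
    · have : X j = (fun p : (ℕ → S) × (ℕ → T) => p.1 (j - k)) ∘ pastMap X N k := by
        funext ω; simp only [Function.comp, pastMap, Nat.add_sub_cancel' hj]
      rw [this, ← MeasurableSpace.comap_comp]
      exact MeasurableSpace.comap_mono
        (measurable_iff_comap_le.1 ((measurable_pi_apply _).comp measurable_fst))
    · have : N j = (fun p : (ℕ → S) × (ℕ → T) => p.2 (j - k)) ∘ pastMap X N k := by
        funext ω; simp only [Function.comp, pastMap, Nat.add_sub_cancel' hj]
      rw [this, ← MeasurableSpace.comap_comp]
      exact MeasurableSpace.comap_mono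
        (measurable_iff_comap_le.1 ((measurable_pi_apply _).comp measurable_snd))
  · rw [← measurable_iff_comap_le]
    have hX : ∀ j, Measurable[pastField X N k] (X (k + j)) := fun j => measurable_iff_comap_le.2
      (le_sup_left.trans (le_iSup₂_of_le (k + j) (Nat.le_add_right _ _) le_rfl))
    have hN : ∀ j, Measurable[pastField X N k] (N (k + j)) := fun j => measurable_iff_comap_le.2
      (le_sup_right.trans (le_iSup₂_of_le (k + j) (Nat.le_add_right _ _) le_rfl))
    refine Measurable.prodMk ?_ ?_
    · exact @measurable_pi_lambda _ _ _ (pastField X N k) _ _ hX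
    · exact @measurable_pi_lambda _ _ _ (pastField X N k) _ _ hN

variable [MeasurableSpace Ω] [MeasurableSpace Ω']

theorem measurable_pastMap {X : ℕ → Ω → S} {N : ℕ → Ω → T} (hX : ∀ k, Measurable (X k))
    (hN : ∀ k, Measurable (N k)) (k : ℕ) : Measurable (pastMap X N k) :=
  (measurable_pi_lambda _ fun _ => hX _).prodMk (measurable_pi_lambda _ fun _ => hN _)

theorem indep_past_iff {X : ℕ → Ω → S} {N : ℕ → Ω → T} {P : Measure Ω} (k l : ℕ) :
    Indep (MeasurableSpace.comap (N k) inferInstance) (pastField X N l) P ↔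
      IndepFun (N k) (pastMap X N l) P := by
  rw [pastField_eq_comap]
  rfl

variable [SMul T S] [SMul T S'] {μ : ℕ → Measure T}

theorem IsSolution.indepFun_pastMap {P : Measure Ω} {X : ℕ → Ω → S} {N : ℕ → Ω → T}
    (h : IsSolution μ P X N) (k : ℕ) : IndepFun (N k) (pastMap X N (k + 1)) P :=
  (indep_past_iff k (k + 1)).1 (h.indep_past k)

theorem indepFun_map_iff {α β : Type*} [MeasurableSpace α] [MeasurableSpace β] {P : Measure Ω'}
    {g : Ω' → Ω} (hg : Measurable g) {f₁ : Ω → α} {f₂ : Ω → β} (h₁ : Measurable f₁)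
    (h₂ : Measurable f₂) : IndepFun f₁ f₂ (P.map g) ↔ IndepFun (f₁ ∘ g) (f₂ ∘ g) P := by
  simp only [indepFun_iff_measure_inter_preimage_eq_mul]
  refine forall₂_congr fun s t => forall₂_congr fun hs ht => ?_
  rw [Measure.map_apply hg ((h₁ hs).inter (h₂ ht)), Measure.map_apply hg (h₁ hs),
    Measure.map_apply hg (h₂ ht)]
  rfl

/-- Being a solution is preserved under a change of the probability space. -/
theorem IsSolution.comp {P : Measure Ω'} {g : Ω' → Ω} (hg : Measurable g) {X : ℕ → Ω → S}
    {N : ℕ → Ω → T} (h : IsSolution μ (P.map g) X N) :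
    IsSolution μ P (fun k => X k ∘ g) (fun k => N k ∘ g) where
  measurable_state k := (h.measurable_state k).comp hg
  measurable_noise k := (h.measurable_noise k).comp hg
  equation k := ae_of_ae_map hg.aemeasurable (h.equation k)
  indep_past k := by
    refine (indep_past_iff (X := fun k => X k ∘ g) (N := fun k => N k ∘ g) k (k + 1)).2 ?_
    exact (indepFun_map_iff hg (h.measurable_noise k)
      (measurable_pastMap h.measurable_state h.measurable_noise _)).1 (h.indepFun_pastMap k)
  law_noise k := by rw [← h.law_noise k, Measure.map_map (h.measurable_noise k) hg]

theorem IsSolution.of_comp [MeasurableEq S] [MeasurableSMul₂ T S] {P : Measure Ω'} {g : Ω' → Ω}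
    (hg : Measurable g) {X : ℕ → Ω → S} {N : ℕ → Ω → T} (hX : ∀ k, Measurable (X k))
    (hN : ∀ k, Measurable (N k))
    (h : IsSolution μ P (fun k => X k ∘ g) (fun k => N k ∘ g)) :
    IsSolution μ (P.map g) X N where
  measurable_state := hX
  measurable_noise := hN
  equation k := by
    exact (ae_map_iff hg.aemeasurable (p := fun ω => X k ω = N k ω • X (k + 1) ω)
      (measurableSet_eq_fun (hX k) ((hN k).smul (hX (k + 1))))).2 (h.equation k)
  indep_past k := by
    rw [indep_past_iff, indepFun_map_iff hg (hN k) (measurable_pastMap hX hN _)]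
    exact h.indepFun_pastMap k
  law_noise k := by rw [← h.law_noise k, Measure.map_map (hN k) hg]

/-- The law of a solution is the law of a coordinate process. -/
theorem IsSolution.map_mem_solutionLaws [MeasurableEq S] [MeasurableSMul₂ T S] {P : Measure Ω}
    [IsProbabilityMeasure P] {X : ℕ → Ω → S} {N : ℕ → Ω → T} (h : IsSolution μ P X N) :
    P.map (fun ω => ((fun k => X k ω), (fun k => N k ω))) ∈ solutionLaws S μ := by
  have hm : Measurable fun ω => ((fun k => X k ω), (fun k => N k ω)) :=
    (measurable_pi_lambda _ h.measurable_state).prodMk (measurable_pi_lambda _ h.measurable_noise)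
  exact ⟨Measure.isProbabilityMeasure_map hm.aemeasurable,
    IsSolution.of_comp hm (fun k => (measurable_pi_apply k).comp measurable_fst)
      (fun k => (measurable_pi_apply k).comp measurable_snd) h⟩

/-- Solutions are preserved by equivariant maps of the state space. -/
theorem IsSolution.map_state {P : Measure Ω} {X : ℕ → Ω → S} {N : ℕ → Ω → T}
    (h : IsSolution μ P X N) {g : S → S'} (hg : Measurable g)
    (heq : ∀ (σ : T) x, g (σ • x) = σ • g x) : IsSolution μ P (fun k => g ∘ X k) N where
  measurable_state k := hg.comp (h.measurable_state k)
  measurable_noise := h.measurable_noise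
  equation k := by
    filter_upwards [h.equation k] with ω hω
    simp only [Function.comp, hω, heq]
  indep_past k := by
    rw [indep_past_iff]
    have hm : Measurable fun p : (ℕ → S) × (ℕ → T) => ((fun j => g (p.1 j)), p.2) :=
      (measurable_pi_lambda _ fun j =>
        hg.comp ((measurable_pi_apply j).comp measurable_fst)).prodMk measurable_snd
    exact (h.indepFun_pastMap k).comp measurable_id hm
  law_noise := h.law_noise

theorem IsSolution.ae_equation {P : Measure Ω} {X : ℕ → Ω → S} {N : ℕ → Ω → T}
    (h : IsSolution μ P X N) : ∀ᵐ ω ∂P, ∀ k, X k ω = N k ω • X (k + 1) ω :=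
  ae_all_iff.2 h.equation

end Past

/-- This is associativity of the product of laws. It lets one factor at a time move from the past
into the noise product. -/
theorem ProbabilityTheory.IndepFun.prodMk_left_of_right {Ω α β γ : Type*} [MeasurableSpace Ω]
    [MeasurableSpace α] [MeasurableSpace β] [MeasurableSpace γ] {P : Measure Ω}
    [IsProbabilityMeasure P] {f : Ω → α} {g : Ω → β} {h : Ω → γ} (hf : Measurable f)
    (hg : Measurable g) (hh : Measurable h) (h₁ : IndepFun f (fun ω => (g ω, h ω)) P)
    (h₂ : IndepFun g h P) : IndepFun (fun ω => (f ω, g ω)) h P := by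
  have h₃ : IndepFun f g P := h₁.comp measurable_id measurable_fst
  rw [indepFun_iff_map_prod_eq_prod_map_map (by fun_prop) (by fun_prop)] at h₁ h₂ h₃ ⊢
  rw [h₃]
  have := Measure.isProbabilityMeasure_map (μ := P) hf.aemeasurable
  have := Measure.isProbabilityMeasure_map (μ := P) hg.aemeasurable
  have := Measure.isProbabilityMeasure_map (μ := P) hh.aemeasurable
  rw [h₂] at h₁
  have h₄ := congrArg (Measure.map MeasurableEquiv.prodAssoc.symm) h₁
  rw [Measure.map_map MeasurableEquiv.prodAssoc.symm.measurable (by fun_prop),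
    ← Measure.prodAssoc_prod, Measure.map_map MeasurableEquiv.prodAssoc.symm.measurable
      MeasurableEquiv.prodAssoc.measurable] at h₄
  rw [MeasurableEquiv.symm_comp_self, Measure.map_id] at h₄
  exact h₄

/-! ### Independence of noise products from the earlier trajectory -/

section NoiseProd

variable {S T Ω : Type*} [MeasurableSpace S] [MeasurableSpace T] [MeasurableSpace Ω]

theorem measurable_noiseProd [Mul T] [MeasurableMul₂ T] {N : ℕ → Ω → T}
    (hN : ∀ k, Measurable (N k)) (k n : ℕ) : Measurable (noiseProd N k n) := by
  induction n with
  | zero => exact hN k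
  | succ n ih => exact ih.mul (hN _)

theorem IsSolution.indepFun_noiseProd [Mul T] [MeasurableMul₂ T] [SMul T S] {μ : ℕ → Measure T}
    {P : Measure Ω} [IsProbabilityMeasure P] {X : ℕ → Ω → S} {N : ℕ → Ω → T}
    (h : IsSolution μ P X N) (k n : ℕ) :
    IndepFun (noiseProd N k n) (pastMap X N (k + n + 1)) P := by
  induction n with
  | zero => exact h.indepFun_pastMap k
  | succ n ih =>
    have hm := measurable_pastMap h.measurable_state h.measurable_noise
    have hφ : Measurable fun p : (ℕ → S) × (ℕ → T) =>
        (p.2 0, ((fun j => p.1 (j + 1)), (fun j => p.2 (j + 1)))) := by fun_prop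
    have h₁ := ih.comp measurable_id hφ
    have heq : (fun p : (ℕ → S) × (ℕ → T) =>
        (p.2 0, ((fun j => p.1 (j + 1)), (fun j => p.2 (j + 1))))) ∘ pastMap X N (k + n + 1) =
        fun ω => (N (k + (n + 1)) ω, pastMap X N (k + (n + 1) + 1) ω) := by
      funext ω
      simp only [Function.comp, pastMap, add_zero]
      refine Prod.ext rfl (Prod.ext ?_ ?_) <;> funext j <;> simp only <;> congr 1 <;> ring
    rw [heq] at h₁
    exact (IndepFun.prodMk_left_of_right (measurable_noiseProd h.measurable_noise k n)
      (h.measurable_noise _) (hm _) h₁ (h.indepFun_pastMap (k + (n + 1)))).comp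
        (φ := fun p : T × T => p.1 * p.2) (ψ := id) (by fun_prop) measurable_id

end NoiseProd

/-! ### The one-dimensional laws of the states determine the law of a solution -/

section Uniqueness

variable {S T : Type*}

/-- Freeze a trajectory after `d` steps, replacing the earlier noise by the constant `t₀`. -/
def truncatePath (t₀ : T) (d : ℕ) (p : (ℕ → S) × (ℕ → T)) : (ℕ → S) × (ℕ → T) :=
  (fun j => p.1 (min j d), fun j => if j < d then p.2 j else t₀)

/-- Prolong a trajectory by one step, driven by the noise `q.1`. -/
def prolong [SMul T S] (q : T × ((ℕ → S) × (ℕ → T))) : (ℕ → S) × (ℕ → T) :=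
  (fun j => Nat.casesOn j (q.1 • q.2.1 0) q.2.1, fun j => Nat.casesOn j q.1 q.2.2)

theorem measurable_truncatePath [MeasurableSpace S] [MeasurableSpace T] (t₀ : T) (d : ℕ) :
    Measurable (truncatePath (S := S) t₀ d) := by
  refine Measurable.prodMk (measurable_pi_lambda _ fun j => by fun_prop)
    (measurable_pi_lambda _ fun j => ?_)
  by_cases hj : j < d <;> simp only [hj, if_true, if_false] <;> fun_prop

theorem measurable_prolong [MeasurableSpace S] [MeasurableSpace T] [SMul T S]
    [MeasurableSMul₂ T S] : Measurable (prolong (S := S) (T := T)) := by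
  refine Measurable.prodMk (measurable_pi_lambda _ fun j => ?_)
    (measurable_pi_lambda _ fun j => ?_) <;> cases j <;> simp only <;> fun_prop

theorem tendsto_truncatePath [TopologicalSpace S] [TopologicalSpace T] (t₀ : T)
    (p : (ℕ → S) × (ℕ → T)) : Tendsto (fun d => truncatePath t₀ d p) atTop (𝓝 p) := by
  refine Tendsto.prodMk_nhds (tendsto_pi_nhds.2 fun j => ?_) (tendsto_pi_nhds.2 fun j => ?_)
  · refine tendsto_const_nhds.congr' ?_
    filter_upwards [eventually_ge_atTop j] with d hd
    rw [min_eq_left hd]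
  · refine tendsto_const_nhds.congr' ?_
    filter_upwards [eventually_gt_atTop j] with d hd
    rw [if_pos hd]

theorem truncatePath_succ_pastMap [SMul T S] {Ω : Type*} {X : ℕ → Ω → S} {N : ℕ → Ω → T} {ω : Ω}
    {k : ℕ} (h : X k ω = N k ω • X (k + 1) ω) (t₀ : T) (d : ℕ) :
    truncatePath t₀ (d + 1) (pastMap X N k ω) =
      prolong (N k ω, truncatePath t₀ d (pastMap X N (k + 1) ω)) := by
  refine Prod.ext (funext fun j => ?_) (funext fun j => ?_)
  · cases j with
    | zero => simpa [truncatePath, prolong, pastMap] using h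
    | succ j => simp [truncatePath, prolong, pastMap, add_comm, add_left_comm]
  · cases j with
    | zero => simp [truncatePath, prolong, pastMap]
    | succ j => simp [truncatePath, prolong, pastMap, add_comm, add_left_comm]

variable [TopologicalSpace S] [TopologicalSpace.MetrizableSpace S] [SecondCountableTopology S]
  [MeasurableSpace S] [BorelSpace S] [TopologicalSpace T] [TopologicalSpace.MetrizableSpace T]
  [SecondCountableTopology T] [MeasurableSpace T] [BorelSpace T] [SMul T S] [MeasurableSMul₂ T S]
  {μ : ℕ → Measure T}

omit [TopologicalSpace S] [TopologicalSpace.MetrizableSpace S] [SecondCountableTopology S]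
  [BorelSpace S] [TopologicalSpace T] [TopologicalSpace.MetrizableSpace T]
  [SecondCountableTopology T] [BorelSpace T] in
-- The noise at a given time is independent of the earlier trajectory, and the new state is a
-- function of both. So the law at depth d + 1 is obtained from the law at depth d, one step
-- earlier, by a recipe involving only μ.
theorem IsSolution.map_truncatePath_succ {Ω : Type*} [MeasurableSpace Ω] {P : Measure Ω}
    [IsProbabilityMeasure P] {X : ℕ → Ω → S} {N : ℕ → Ω → T} (h : IsSolution μ P X N) (t₀ : T)
    (d k : ℕ) : P.map (truncatePath t₀ (d + 1) ∘ pastMap X N k) =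
      ((μ k).prod (P.map (truncatePath t₀ d ∘ pastMap X N (k + 1)))).map prolong := by
  have hm := measurable_pastMap h.measurable_state h.measurable_noise
  have hi : IndepFun (N k) (truncatePath t₀ d ∘ pastMap X N (k + 1)) P :=
    (h.indepFun_pastMap k).comp measurable_id (measurable_truncatePath t₀ d)
  rw [indepFun_iff_map_prod_eq_prod_map_map (h.measurable_noise k).aemeasurable
    ((measurable_truncatePath t₀ d).comp (hm _)).aemeasurable] at hi
  rw [← h.law_noise k, ← hi, Measure.map_map measurable_prolong
    ((h.measurable_noise k).prodMk ((measurable_truncatePath t₀ d).comp (hm _)))]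
  refine Measure.map_congr ?_
  filter_upwards [h.equation k] with ω hω
  exact truncatePath_succ_pastMap hω t₀ d

/-- The law of a solution is determined by the laws of the single states. -/
theorem IsSolution.map_eq_of_map_state_eq {Ω Ω' : Type*} [MeasurableSpace Ω] [MeasurableSpace Ω']
    {P : Measure Ω} {P' : Measure Ω'} [IsProbabilityMeasure P] [IsProbabilityMeasure P']
    {X : ℕ → Ω → S} {N : ℕ → Ω → T} {X' : ℕ → Ω' → S} {N' : ℕ → Ω' → T}
    (h : IsSolution μ P X N) (h' : IsSolution μ P' X' N')
    (heq : ∀ k, P.map (X k) = P'.map (X' k)) :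
    P.map (fun ω => ((fun k => X k ω), (fun k => N k ω))) =
      P'.map (fun ω => ((fun k => X' k ω), (fun k => N' k ω))) := by
  have hm := measurable_pastMap h.measurable_state h.measurable_noise
  have hm' := measurable_pastMap h'.measurable_state h'.measurable_noise
  obtain ⟨t₀⟩ : Nonempty T := by
    obtain ⟨ω⟩ := P.nonempty_of_neZero
    exact ⟨N 0 ω⟩
  -- The induction on the depth runs over all `k` at once, since depth d + 1 at `k` uses depth d at
  -- `k + 1`.
  have key : ∀ d k, P.map (truncatePath t₀ d ∘ pastMap X N k) =
      P'.map (truncatePath t₀ d ∘ pastMap X' N' k) := by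
    intro d
    induction d with
    | zero =>
      intro k
      let c : S → (ℕ → S) × (ℕ → T) := fun x => (fun _ => x, fun _ => t₀)
      have hc : Measurable c := by fun_prop
      have h1 : truncatePath t₀ 0 ∘ pastMap X N k = c ∘ X k := by
        funext ω; simp [truncatePath, pastMap, c]
      have h2 : truncatePath t₀ 0 ∘ pastMap X' N' k = c ∘ X' k := by
        funext ω; simp [truncatePath, pastMap, c]
      rw [h1, h2, ← Measure.map_map hc (h.measurable_state k),
        ← Measure.map_map hc (h'.measurable_state k), heq k]
    | succ d ih =>
      intro k
      rw [h.map_truncatePath_succ, h'.map_truncatePath_succ, ih]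
  have h0 : (fun ω => ((fun k => X k ω), (fun k => N k ω))) = pastMap X N 0 := by
    funext ω; simp [pastMap]
  have h0' : (fun ω => ((fun k => X' k ω), (fun k => N' k ω))) = pastMap X' N' 0 := by
    funext ω; simp [pastMap]
  rw [h0, h0']
  have := Measure.isProbabilityMeasure_map (μ := P) (hm 0).aemeasurable
  have := Measure.isProbabilityMeasure_map (μ := P') (hm' 0).aemeasurable
  refine ext_of_forall_integral_eq_of_IsFiniteMeasure fun f => ?_
  -- Frozen trajectories converge pointwise to the full one, so their laws converge weakly and fix
  -- the full law.
  have hlim : ∀ (L : Measure ((ℕ → S) × (ℕ → T))) [IsProbabilityMeasure L],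
      Tendsto (fun d => ∫ p, f p ∂(L.map (truncatePath t₀ d))) atTop (𝓝 (∫ p, f p ∂L)) := by
    intro L _
    have : ∀ d, ∫ p, f p ∂(L.map (truncatePath t₀ d)) = ∫ p, f (truncatePath t₀ d p) ∂L := fun d =>
      integral_map (measurable_truncatePath t₀ d).aemeasurable
        f.continuous.measurable.aestronglyMeasurable
    simp_rw [this]
    refine tendsto_integral_of_dominated_convergence (fun _ => ‖f‖)
      (fun d => (f.continuous.measurable.comp (measurable_truncatePath t₀ d)).aestronglyMeasurable)
      (integrable_const _) (fun d => ae_of_all _ fun p => f.norm_coe_le_norm _)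
      (ae_of_all _ fun p => (f.continuous.tendsto p).comp (tendsto_truncatePath t₀ p))
  refine tendsto_nhds_unique (hlim _) ((hlim _).congr fun d => ?_)
  rw [Measure.map_map (measurable_truncatePath t₀ d) (hm 0),
    Measure.map_map (measurable_truncatePath t₀ d) (hm' 0), key]

end Uniqueness

/-- Along an ultrafilter `u n` tends to some hx with h in `H`. By compactness of `T` the functions σ
↦ φ(σ `u n`) then converge uniformly, so weak convergence of `K n` yields the integral of φ(σhx)
against ν; right invariance of ν removes h. -/
theorem tendsto_integral_smul_of_asympOrbit {S T : Type*} [TopologicalSpace S] [CompactSpace S]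
    [TopologicalSpace T] [CompactSpace T] [MeasurableSpace T] [BorelSpace T]
    [Semigroup T] [ContinuousMul T] [SemigroupAction T S] [ContinuousSMul T S]
    {H : Subsemigroup T} {K : ℕ → Measure T} [∀ n, IsProbabilityMeasure (K n)] {ν : Measure T}
    [IsProbabilityMeasure ν] (hK : ∀ f : C(T, ℝ), Tendsto (fun n => ∫ σ, f σ ∂(K n)) atTop
      (𝓝 (∫ σ, f σ ∂ν)))
    (hν : ∀ h ∈ H, ν.map (fun σ => σ * h) = ν) {x : S} {u : ℕ → S} (hu : AsympOrbit H x u)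
    (φ : C(S, ℝ)) :
    Tendsto (fun n => ∫ σ, φ (σ • u n) ∂(K n)) atTop (𝓝 (∫ σ, φ (σ • x) ∂ν)) := by
  let F : C(S, C(T, ℝ)) := ContinuousMap.curry
    ⟨fun p : S × T => φ (p.2 • p.1), φ.continuous.comp (continuous_snd.smul continuous_fst)⟩
  have hF : ∀ y σ, F y σ = φ (σ • y) := fun _ _ => rfl
  have hint : ∀ (f : C(T, ℝ)) (L : Measure T) [IsProbabilityMeasure L], Integrable f L := by
    intro f L _
    exact (BoundedContinuousFunction.mkOfCompact f).integrable L
  rw [tendsto_iff_ultrafilter]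
  intro U hU
  obtain ⟨y, hy⟩ := U.exists_tendsto_of_compactSpace u
  have hinv : ∫ σ, φ (σ • x) ∂ν = ∫ σ, F y σ ∂ν := by
    obtain ⟨h, hh, rfl⟩ := hu U hU y hy
    have hc : Continuous fun σ : T => φ (σ • x) :=
      φ.continuous.comp (continuous_id.smul continuous_const)
    conv_lhs => rw [← hν h hh]
    have hm : Continuous fun σ : T => σ * h := continuous_id.mul continuous_const
    rw [integral_map hm.measurable.aemeasurable
      hc.measurable.aestronglyMeasurable]
    simp only [hF, mul_smul]
  rw [hinv]
  have h1 : Tendsto (fun n => ‖F (u n) - F y‖) U (𝓝 0) := by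
    rw [← tendsto_iff_norm_sub_tendsto_zero]
    exact (F.continuous.tendsto y).comp hy
  have h2 : Tendsto (fun n => ∫ σ, F (u n) σ ∂(K n) - ∫ σ, F y σ ∂(K n)) U (𝓝 0) := by
    refine squeeze_zero_norm (fun n => ?_) h1
    rw [← integral_sub (hint _ _) (hint _ _)]
    have := norm_integral_le_of_norm_le_const (μ := K n) (f := fun σ => F (u n) σ - F y σ)
      (C := ‖F (u n) - F y‖) (ae_of_all _ fun σ => (F (u n) - F y).norm_coe_le_norm σ)
    simpa using this
  have h3 := h2.add ((hK (F y)).mono_left hU)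
  simpa [hF] using h3

/-! ### Laws of the states and of the noise of a solution -/

section Solutions

variable {S T : Type*} [TopologicalSpace S] [CompactSpace S] [TopologicalSpace.MetrizableSpace S]
  [SecondCountableTopology S] [MeasurableSpace S] [BorelSpace S] [TopologicalSpace T]
  [CompactSpace T] [TopologicalSpace.MetrizableSpace T] [SecondCountableTopology T]
  [MeasurableSpace T] [BorelSpace T] [Semigroup T] [ContinuousMul T] [SemigroupAction T S]
  [ContinuousSMul T S] {μ : ℕ → Measure T}

omit [TopologicalSpace S] [CompactSpace S] [TopologicalSpace.MetrizableSpace S]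
  [SecondCountableTopology S] [BorelSpace S] [TopologicalSpace T] [CompactSpace T]
  [TopologicalSpace.MetrizableSpace T] [SecondCountableTopology T] [BorelSpace T]
  [ContinuousMul T] [ContinuousSMul T S] in
theorem IsSolution.ae_eq_noiseProd_smul {Ω : Type*} [MeasurableSpace Ω] {P : Measure Ω}
    {X : ℕ → Ω → S} {N : ℕ → Ω → T} (h : IsSolution μ P X N) (k n : ℕ) :
    ∀ᵐ ω ∂P, X k ω = noiseProd N k n ω • X (k + n + 1) ω := by
  filter_upwards [h.ae_equation] with ω hω
  rw [noiseProd_eq_pathProd]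
  exact eq_pathProd_smul (x := fun k => X k ω) hω k n

omit [CompactSpace T] [TopologicalSpace.MetrizableSpace S]
  [TopologicalSpace.MetrizableSpace T] in
theorem IsSolution.integral_state_eq {Ω : Type*} [MeasurableSpace Ω] {P : Measure Ω}
    [IsProbabilityMeasure P] {X : ℕ → Ω → S} {N : ℕ → Ω → T} (h : IsSolution μ P X N)
    (φ : C(S, ℝ)) (k n : ℕ) : ∫ ω, φ (X k ω) ∂P =
      ∫ ω, (∫ σ, φ (σ • X (k + n + 1) ω) ∂(P.map (noiseProd N k n))) ∂P := by
  have hN := measurable_noiseProd h.measurable_noise k n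
  have hX := h.measurable_state (k + n + 1)
  have hi : IndepFun (noiseProd N k n) (X (k + n + 1)) P :=
    (h.indepFun_noiseProd k n).comp (φ := id) (ψ := fun p : (ℕ → S) × (ℕ → T) => p.1 0)
      measurable_id (by fun_prop)
  rw [indepFun_iff_map_prod_eq_prod_map_map hN.aemeasurable hX.aemeasurable] at hi
  have := Measure.isProbabilityMeasure_map (μ := P) hN.aemeasurable
  have := Measure.isProbabilityMeasure_map (μ := P) hX.aemeasurable
  have hc : Continuous fun p : T × S => φ (p.1 • p.2) :=
    φ.continuous.comp (continuous_fst.smul continuous_snd)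
  have hint : ∀ (L : Measure (T × S)) [IsProbabilityMeasure L],
      Integrable (fun p : T × S => φ (p.1 • p.2)) L := by
    intro L _
    refine Integrable.of_bound hc.measurable.aestronglyMeasurable ‖φ‖ (ae_of_all _ fun p => ?_)
    exact φ.norm_coe_le_norm _
  calc ∫ ω, φ (X k ω) ∂P = ∫ ω, φ (noiseProd N k n ω • X (k + n + 1) ω) ∂P := by
        refine integral_congr_ae ?_
        filter_upwards [h.ae_eq_noiseProd_smul k n] with ω hω
        rw [hω]
    _ = ∫ p, φ (p.1 • p.2) ∂((P.map (noiseProd N k n)).prod (P.map (X (k + n + 1)))) := by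
        rw [← hi, integral_map (hN.prodMk hX).aemeasurable hc.measurable.aestronglyMeasurable]
    _ = ∫ y, ∫ σ, φ (σ • y) ∂(P.map (noiseProd N k n)) ∂(P.map (X (k + n + 1))) :=
        integral_prod_symm _ (hint _)
    _ = _ := by
        rw [integral_map hX.aemeasurable]
        exact ((hint _).integral_prod_right).aestronglyMeasurable

/-- Along a solution with a deterministic asymptotic orbit, the states have a law which is
determined by this orbit. -/
theorem IsSolution.integral_state_eq_of_asympOrbit {H : Subsemigroup T} {Ω : Type*}
    [MeasurableSpace Ω] {P : Measure Ω} [IsProbabilityMeasure P] {X : ℕ → Ω → S} {N : ℕ → Ω → T}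
    (h : IsSolution μ P X N) {x : S} (hx : ∀ᵐ ω ∂P, AsympOrbit H x fun n => X n ω) {k : ℕ}
    {ν : Measure T} [IsProbabilityMeasure ν] (hν : ∀ g ∈ H, ν.map (fun σ => σ * g) = ν)
    (hlim : ∀ f : C(T, ℝ), Tendsto (fun n => ∫ ω, f (noiseProd N k n ω) ∂P) atTop
      (𝓝 (∫ σ, f σ ∂ν))) (φ : C(S, ℝ)) :
    ∫ ω, φ (X k ω) ∂P = ∫ σ, φ (σ • x) ∂ν := by
  have hN := measurable_noiseProd h.measurable_noise k
  have : ∀ n, IsProbabilityMeasure (P.map (noiseProd N k n)) := fun n =>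
    Measure.isProbabilityMeasure_map (hN n).aemeasurable
  have hlim' : ∀ f : C(T, ℝ), Tendsto (fun n => ∫ σ, f σ ∂(P.map (noiseProd N k n))) atTop
      (𝓝 (∫ σ, f σ ∂ν)) := fun f => (hlim f).congr fun n =>
    (integral_map (hN n).aemeasurable f.continuous.measurable.aestronglyMeasurable).symm
  have hc : ∀ n, Continuous fun y => ∫ σ, φ (σ • y) ∂(P.map (noiseProd N k n)) := by
    intro n
    refine continuous_of_dominated (bound := fun _ => ‖φ‖) (fun y => ?_) (fun y => ?_)
      (integrable_const _) ?_
    · exact (φ.continuous.comp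
        (continuous_id.smul continuous_const)).measurable.aestronglyMeasurable
    · exact ae_of_all _ fun σ => φ.norm_coe_le_norm _
    · exact ae_of_all _ fun σ => φ.continuous.comp (continuous_const.smul continuous_id)
  have h1 : Tendsto (fun n => ∫ ω, (∫ σ, φ (σ • X (k + n + 1) ω) ∂(P.map (noiseProd N k n))) ∂P)
      atTop (𝓝 (∫ _, (∫ σ, φ (σ • x) ∂ν) ∂P)) := by
    refine tendsto_integral_of_dominated_convergence (fun _ => ‖φ‖) (fun n => ?_)
      (integrable_const _) (fun n => ae_of_all _ fun ω => ?_) ?_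
    · exact ((hc n).measurable.comp (h.measurable_state _)).aestronglyMeasurable
    · refine (norm_integral_le_of_norm_le_const (C := ‖φ‖)
        (ae_of_all _ fun σ => φ.norm_coe_le_norm _)).trans ?_
      simp
    · filter_upwards [hx] with ω hω
      refine tendsto_integral_smul_of_asympOrbit hlim' hν (H := H) ?_ φ
      intro U hU y hy
      have hs : Tendsto (fun n => k + n + 1) atTop atTop :=
        tendsto_atTop_mono (fun n => by simp only [id]; lia) tendsto_id
      exact hω (U.map fun n => k + n + 1) (hs.mono_left hU) y
        (by rw [Ultrafilter.coe_map, tendsto_map'_iff]; exact hy)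
  simp only [integral_const, probReal_univ, one_smul] at h1
  exact tendsto_nhds_unique (tendsto_const_nhds.congr fun n => h.integral_state_eq φ k n) h1

omit [TopologicalSpace T] [CompactSpace T] [TopologicalSpace.MetrizableSpace T]
  [SecondCountableTopology T] [BorelSpace T] [Semigroup T] [ContinuousMul T]
  [SemigroupAction T S] [ContinuousSMul T S] in
/-- A noise process drives the trivial solution on a one-point state space. -/
theorem IsNoise.isSolution_punit {Ω : Type*} [MeasurableSpace Ω] {P : Measure Ω}
    [IsProbabilityMeasure P] {N : ℕ → Ω → T} (h : IsNoise μ P N) :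
    IsSolution μ P (fun _ _ => PUnit.unit.{1}) N where
  measurable_state _ := measurable_const
  measurable_noise := h.measurable_noise
  equation _ := ae_of_all _ fun _ => rfl
  indep_past k := by
    have h1 := indep_iSup_of_disjoint (fun j => (h.measurable_noise j).comap_le) h.indep
      (S := {k}) (T := {j | k + 1 ≤ j}) (by simp)
    rw [iSup_singleton] at h1
    refine indep_of_indep_of_le_right h1 (iSup₂_mono fun j hj => ?_)
    simp
  law_noise := h.law_noise

omit [TopologicalSpace S] [CompactSpace S] [TopologicalSpace.MetrizableSpace S]
  [SecondCountableTopology S] [BorelSpace S] [CompactSpace T] [ContinuousMul T]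
  [ContinuousSMul T S] in
/-- All solutions with the same noise law have the same law of the noise process. -/
theorem IsSolution.map_noise_eq {S' Ω Ω' : Type*} [MeasurableSpace S'] [SMul T S']
    [MeasurableSpace Ω] [MeasurableSpace Ω'] {P : Measure Ω} [IsProbabilityMeasure P]
    {P' : Measure Ω'} [IsProbabilityMeasure P'] {X : ℕ → Ω → S} {N : ℕ → Ω → T}
    {X' : ℕ → Ω' → S'} {N' : ℕ → Ω' → T} (h : IsSolution μ P X N) (h' : IsSolution μ P' X' N') :
    P.map (fun ω k => N k ω) = P'.map (fun ω k => N' k ω) := by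
  -- Over a one-point state space the laws of single states agree trivially, so uniqueness applies
  -- and only the noise remains.
  have h1 : IsSolution μ P (fun _ _ => PUnit.unit.{1}) N :=
    h.map_state (g := fun _ => PUnit.unit) measurable_const fun _ _ => rfl
  have h1' : IsSolution μ P' (fun _ _ => PUnit.unit.{1}) N' :=
    h'.map_state (g := fun _ => PUnit.unit) measurable_const fun _ _ => rfl
  have : MeasurableSMul₂ T PUnit.{1} := ⟨measurable_of_subsingleton_codomain _⟩
  have h2 := h1.map_eq_of_map_state_eq h1' fun k => by
    rw [Measure.map_const, Measure.map_const, measure_univ, measure_univ]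
  have h3 := congrArg (Measure.map Prod.snd) h2
  have hm : Measurable fun ω => ((fun _ : ℕ => PUnit.unit.{1}), fun k => N k ω) :=
    measurable_const.prodMk (measurable_pi_lambda _ h.measurable_noise)
  have hm' : Measurable fun ω => ((fun _ : ℕ => PUnit.unit.{1}), fun k => N' k ω) :=
    measurable_const.prodMk (measurable_pi_lambda _ h'.measurable_noise)
  rw [Measure.map_map measurable_snd hm, Measure.map_map measurable_snd hm'] at h3
  exact h3

end Solutions

/-! ### Consequences of the coset condition for arbitrary solutions -/

section Limits

variable {S T : Type*} [TopologicalSpace S] [CompactSpace S] [TopologicalSpace.MetrizableSpace S]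
  [SecondCountableTopology S] [MeasurableSpace S] [BorelSpace S] [TopologicalSpace T]
  [CompactSpace T] [TopologicalSpace.MetrizableSpace T] [SecondCountableTopology T]
  [MeasurableSpace T] [BorelSpace T] [Semigroup T] [ContinuousMul T] [SemigroupAction T S]
  [ContinuousSMul T S] {μ : ℕ → Measure T} {H : Subsemigroup T}

theorem exists_continuousMap_separating_cosets (hc : IsCompact (H : Set T))
    (hne : (H : Set T).Nonempty) : ∃ Ψ : ℕ → C(T, ℝ), ∀ σ τ, (∀ n, Ψ n σ = Ψ n τ) ↔
      (fun h => σ * h) '' (H : Set T) = (fun h => τ * h) '' (H : Set T) :=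
  exists_continuousMap_separating_images hc hne (fun σ h => σ * h) continuous_mul

theorem exists_continuousMap_separating_orbits (hc : IsCompact (H : Set T))
    (hne : (H : Set T).Nonempty) : ∃ Φ : ℕ → C(S, ℝ), ∀ x y, (∀ n, Φ n x = Φ n y) ↔
      (fun h : T => h • x) '' (H : Set T) = (fun h : T => h • y) '' (H : Set T) :=
  exists_continuousMap_separating_images hc hne (fun x h => h • x)
    (continuous_snd.smul continuous_fst)

/-- Countably many separating functions reduce the condition to countably many convergence
statements. Measurability is what allows the property to pass from one probability space to another
through the law of the noise. -/
theorem measurableSet_cosetStable (hc : IsCompact (H : Set T)) (hne : (H : Set T).Nonempty) :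
    MeasurableSet {t : ℕ → T | CosetStable H t} := by
  obtain ⟨Ψ, hΨ⟩ := exists_continuousMap_separating_cosets hc hne
  simp_rw [cosetStable_iff_tendsto hΨ]
  rw [Set.ofPred_forall]
  exact MeasurableSet.iInter fun i => measurableSet_exists_tendsto fun n =>
    ((Ψ i).continuous.comp (continuous_pathProd 0 n)).measurable

variable {Ω₀ : Type*} [MeasurableSpace Ω₀] {P₀ : Measure Ω₀} [IsProbabilityMeasure P₀]
  {N₀ : ℕ → Ω₀ → T}

theorem SatisfiesP2.ae_cosetStable (hP2 : SatisfiesP2 P₀ N₀ H) :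
    ∀ᵐ ω ∂P₀, CosetStable H fun k => N₀ k ω := by
  obtain ⟨Ψ, hΨ⟩ := exists_continuousMap_separating_cosets hP2.isCompact hP2.nontrivial.nonempty
  filter_upwards [hP2.tendsto_coset 0] with ω hω
  obtain ⟨c, hc⟩ := hω
  simp_rw [noiseProd_eq_pathProd] at hc
  exact (cosetStable_iff_tendsto hΨ).2 fun i => tendsto_of_tendsto_toCoset hc fun σ τ h =>
    (hΨ σ τ).2 h i

theorem SatisfiesP2.exists_limit_law (hP2 : SatisfiesP2 P₀ N₀ H) (k : ℕ) :
    ∃ ν : Measure T, IsProbabilityMeasure ν ∧ (∀ h ∈ H, ν.map (fun σ => σ * h) = ν) ∧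
      ∀ f : C(T, ℝ), Tendsto (fun n => ∫ ω, f (noiseProd N₀ k n ω) ∂P₀) atTop
        (𝓝 (∫ σ, f σ ∂ν)) := by
  obtain ⟨ν, hν, hlim⟩ := hP2.tendsto_law k
  refine ⟨ν, inferInstance, hν, fun f => ?_⟩
  have h1 := ProbabilityMeasure.tendsto_iff_forall_integral_tendsto.1 hlim.tendsto
    (BoundedContinuousFunction.mkOfCompact f)
  simp only [ProbabilityMeasure.coe_mk, Measure.map_id,
    BoundedContinuousFunction.mkOfCompact_apply] at h1
  refine h1.congr fun n => ?_
  exact integral_map (hlim.forall_aemeasurable n) f.continuous.measurable.aestronglyMeasurable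

variable (hN₀ : IsNoise μ P₀ N₀) (hP2 : SatisfiesP2 P₀ N₀ H)

include hN₀ in
-- The coset condition is imposed on one given noise process; equality of noise laws carries its
-- almost sure consequences over to every solution.
theorem IsSolution.ae_noise {Ω : Type*} [MeasurableSpace Ω] {P : Measure Ω}
    [IsProbabilityMeasure P] {X : ℕ → Ω → S} {N : ℕ → Ω → T} (h : IsSolution μ P X N)
    {A : Set (ℕ → T)} (hA : MeasurableSet A) (h₀ : ∀ᵐ ω ∂P₀, (fun k => N₀ k ω) ∈ A) :
    ∀ᵐ ω ∂P, (fun k => N k ω) ∈ A := by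
  have heq := h.map_noise_eq hN₀.isSolution_punit
  have hm := (measurable_pi_lambda _ h.measurable_noise).aemeasurable (μ := P)
  have hm₀ := (measurable_pi_lambda _ hN₀.measurable_noise).aemeasurable (μ := P₀)
  have h1 : ∀ᵐ t ∂(P₀.map fun ω k => N₀ k ω), t ∈ A := (ae_map_iff hm₀ hA).2 h₀
  rw [← heq] at h1
  exact (ae_map_iff hm hA).1 h1

include hN₀ in
theorem IsSolution.integral_noiseProd {Ω : Type*} [MeasurableSpace Ω] {P : Measure Ω}
    [IsProbabilityMeasure P] {X : ℕ → Ω → S} {N : ℕ → Ω → T} (h : IsSolution μ P X N)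
    (f : C(T, ℝ)) (k n : ℕ) :
    ∫ ω, f (noiseProd N k n ω) ∂P = ∫ ω, f (noiseProd N₀ k n ω) ∂P₀ := by
  have heq := h.map_noise_eq hN₀.isSolution_punit
  have hm := (measurable_pi_lambda _ h.measurable_noise).aemeasurable (μ := P)
  have hm₀ := (measurable_pi_lambda _ hN₀.measurable_noise).aemeasurable (μ := P₀)
  have hf := (f.continuous.comp (continuous_pathProd k n)).measurable
  have h1 := integral_map hm (f := fun t => f (pathProd t k n)) hf.aestronglyMeasurable
  have h2 := integral_map hm₀ (f := fun t => f (pathProd t k n)) hf.aestronglyMeasurable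
  rw [heq] at h1
  simp_rw [noiseProd_eq_pathProd]
  rw [← h1, ← h2]

include hN₀ hP2 in
theorem IsSolution.ae_cosetStable {Ω : Type*} [MeasurableSpace Ω] {P : Measure Ω}
    [IsProbabilityMeasure P] {X : ℕ → Ω → S} {N : ℕ → Ω → T} (h : IsSolution μ P X N) :
    ∀ᵐ ω ∂P, CosetStable H fun k => N k ω :=
  h.ae_noise hN₀ (measurableSet_cosetStable hP2.isCompact hP2.nontrivial.nonempty)
    hP2.ae_cosetStable

include hN₀ hP2 in
/-- A solution with a deterministic asymptotic orbit has a law determined by this orbit. -/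
theorem IsSolution.map_eq_of_asympOrbit {Ω Ω' : Type*} [MeasurableSpace Ω] [MeasurableSpace Ω']
    {P : Measure Ω} {P' : Measure Ω'} [IsProbabilityMeasure P] [IsProbabilityMeasure P']
    {X : ℕ → Ω → S} {N : ℕ → Ω → T} {X' : ℕ → Ω' → S} {N' : ℕ → Ω' → T}
    (h : IsSolution μ P X N) (h' : IsSolution μ P' X' N') {x : S}
    (hx : ∀ᵐ ω ∂P, AsympOrbit H x fun n => X n ω)
    (hx' : ∀ᵐ ω ∂P', AsympOrbit H x fun n => X' n ω) :
    P.map (fun ω => ((fun k => X k ω), (fun k => N k ω))) =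
      P'.map (fun ω => ((fun k => X' k ω), (fun k => N' k ω))) := by
  refine h.map_eq_of_map_state_eq h' fun k => ?_
  obtain ⟨ν, hνp, hν, hlim⟩ := hP2.exists_limit_law k
  have := Measure.isProbabilityMeasure_map (μ := P) (h.measurable_state k).aemeasurable
  have := Measure.isProbabilityMeasure_map (μ := P') (h'.measurable_state k).aemeasurable
  refine ext_of_forall_integral_eq_of_IsFiniteMeasure fun φ => ?_
  rw [integral_map (h.measurable_state k).aemeasurable
      φ.continuous.measurable.aestronglyMeasurable,
    integral_map (h'.measurable_state k).aemeasurable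
      φ.continuous.measurable.aestronglyMeasurable]
  have h1 := h.integral_state_eq_of_asympOrbit hx hν (fun f => (hlim f).congr fun n =>
    (h.integral_noiseProd hN₀ f k n).symm) φ.toContinuousMap
  have h2 := h'.integral_state_eq_of_asympOrbit hx' hν (fun f => (hlim f).congr fun n =>
    (h'.integral_noiseProd hN₀ f k n).symm) φ.toContinuousMap
  exact h1.trans h2.symm

variable (hT : ∀ σ σ₁ σ₂ : T, σ * σ₁ = σ * σ₂ → σ₁ = σ₂)
  (hS : ∀ (σ : T) (x y : S), σ • x = σ • y → x = y)

include hN₀ hP2 hT hS in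
theorem IsSolution.ae_exists_asympOrbit {Ω : Type*} [MeasurableSpace Ω] {P : Measure Ω}
    [IsProbabilityMeasure P] {X : ℕ → Ω → S} {N : ℕ → Ω → T} (h : IsSolution μ P X N) :
    ∀ᵐ ω ∂P, ∃ y, AsympOrbit H y fun n => X n ω := by
  filter_upwards [h.ae_cosetStable hN₀ hP2, h.ae_equation] with ω h1 h2
  exact h1.exists_asympOrbit hP2.isSubgroup hT hS h2

end Limits

/-! ### Existence of a solution approaching a given orbit -/

section Existence

variable {S T : Type*} [TopologicalSpace S] [CompactSpace S] [TopologicalSpace.MetrizableSpace S]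
  [SecondCountableTopology S] [MeasurableSpace S] [BorelSpace S] [TopologicalSpace T]
  [CompactSpace T] [TopologicalSpace.MetrizableSpace T] [SecondCountableTopology T]
  [MeasurableSpace T] [BorelSpace T] [Semigroup T] [ContinuousMul T] [SemigroupAction T S]
  [ContinuousSMul T S] {μ : ℕ → Measure T} {H : Subsemigroup T}

/-- The state process which starts from `x` at the time `-l` and is driven by the noise `t`. -/
noncomputable def startedAt (x : S) (l : ℕ) (t : ℕ → T) (k : ℕ) : S :=
  if k < l then pathProd t k (l - 1 - k) • x else x

theorem startedAt_add_succ (x : S) (t : ℕ → T) (k n : ℕ) :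
    startedAt x (k + n + 1) t k = pathProd t k n • x := by
  rw [startedAt, if_pos (by lia)]
  congr 2
  lia

theorem startedAt_eq_smul (x : S) {l : ℕ} (t : ℕ → T) {k : ℕ} (hk : k < l) :
    startedAt x l t k = t k • startedAt x l t (k + 1) := by
  obtain ⟨n, rfl⟩ := Nat.exists_eq_add_of_lt hk
  rw [startedAt_add_succ]
  cases n with
  | zero => simp [startedAt, pathProd, noiseProd]
  | succ n =>
    have h1 : k + (n + 1) + 1 = (k + 1) + n + 1 := by ring
    have h2 := pathProd_add t k 0 n
    simp only [add_zero, zero_add] at h2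
    rw [h1, startedAt_add_succ, h2, mul_smul]
    rfl

theorem startedAt_congr (x : S) (l : ℕ) {t t' : ℕ → T} {k : ℕ} (h : ∀ j, k ≤ j → t j = t' j) :
    startedAt x l t k = startedAt x l t' k := by
  have : ∀ n, pathProd t k n = pathProd t' k n := by
    intro n
    rw [pathProd_shift t, pathProd_shift t']
    congr 1
    funext j
    exact h _ (Nat.le_add_right _ _)
  simp only [startedAt, this]

theorem continuous_startedAt (x : S) (l k : ℕ) :
    Continuous fun t : ℕ → T => startedAt x l t k := by
  unfold startedAt
  split_ifs
  · exact (continuous_pathProd k _).smul continuous_const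
  · exact continuous_const

theorem continuous_startedAt_past (x : S) (l k : ℕ) :
    Continuous fun t : ℕ → T => ((fun j => startedAt x l t (k + j)), fun j => t (k + j)) :=
  (continuous_pi fun j => continuous_startedAt x l (k + j)).prodMk
    (continuous_pi fun _ => continuous_apply _)

variable {Ω₀ : Type*} [MeasurableSpace Ω₀] {P₀ : Measure Ω₀} [IsProbabilityMeasure P₀]
  {N₀ : ℕ → Ω₀ → T} (hN₀ : IsNoise μ P₀ N₀) (hP2 : SatisfiesP2 P₀ N₀ H)

/-- A noise variable is independent of the trajectory, started from `x`, before its time. -/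
theorem IsNoise.indepFun_startedAt (hN₀ : IsNoise μ P₀ N₀) (x : S) (l k : ℕ) :
    IndepFun (N₀ k) (fun ω => ((fun j => startedAt x l (fun i => N₀ i ω) (k + 1 + j)),
      fun j => N₀ (k + 1 + j) ω)) P₀ := by
  have h1 := hN₀.isSolution_punit.indepFun_pastMap k
  have hs : Measurable fun p : (ℕ → PUnit.{1}) × (ℕ → T) =>
      ((fun j => startedAt x l (fun i => p.2 (i - (k + 1))) (k + 1 + j)), p.2) := by
    refine Measurable.prodMk (measurable_pi_lambda _ fun j => ?_) measurable_snd
    exact (continuous_startedAt x l (k + 1 + j)).measurable.comp (by fun_prop)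
  refine (h1.comp measurable_id hs).congr (ae_of_all _ fun _ => rfl) (ae_of_all _ fun ω => ?_)
  refine Prod.ext (funext fun j => ?_) rfl
  refine startedAt_congr x l fun i hi => ?_
  simp only [pastMap]
  congr 1
  lia

/-- A weak limit of the processes started from `x` in the remote past. -/
theorem IsNoise.exists_weak_limit (hN₀ : IsNoise μ P₀ N₀) (x : S) :
    ∃ (U : Ultrafilter ℕ) (L : Measure ((ℕ → S) × (ℕ → T))), ↑U ≤ (atTop : Filter ℕ) ∧
      IsProbabilityMeasure L ∧ ∀ f : C((ℕ → S) × (ℕ → T), ℝ),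
        Tendsto (fun l => ∫ ω, f (startedAt x l (fun i => N₀ i ω), fun i => N₀ i ω) ∂P₀) U
          (𝓝 (∫ p, f p ∂L)) := by
  have hm : ∀ l, AEMeasurable
      (fun ω => (startedAt x l (fun i => N₀ i ω), fun i => N₀ i ω)) P₀ := by
    intro l
    have h1 := (continuous_startedAt_past (T := T) x l 0).measurable.comp
      (measurable_pi_lambda _ hN₀.measurable_noise)
    simp only [zero_add] at h1
    exact h1.aemeasurable
  let ρ : ℕ → ProbabilityMeasure ((ℕ → S) × (ℕ → T)) := fun l =>
    ⟨P₀.map fun ω => (startedAt x l (fun i => N₀ i ω), fun i => N₀ i ω),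
      Measure.isProbabilityMeasure_map (hm l)⟩
  -- Probability measures on a compact metrizable space form a compact space, so the laws converge
  -- along an ultrafilter.
  obtain ⟨L, hL⟩ := (Ultrafilter.of (atTop : Filter ℕ)).exists_tendsto_of_compactSpace ρ
  refine ⟨_, L, Ultrafilter.of_le _, inferInstance, fun f => ?_⟩
  have h1 := ProbabilityMeasure.tendsto_iff_forall_integral_tendsto.1 hL
    (BoundedContinuousFunction.mkOfCompact f)
  refine h1.congr fun l => ?_
  exact integral_map (hm l) f.continuous.measurable.aestronglyMeasurable

include hN₀ in
-- Every clause can be tested on integrals of continuous functions: the equation on the distance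
-- between its two sides, independence on products, and the noise law on a quantity that does not
-- depend on the starting time.
theorem isSolution_of_weak_limit {x : S} {U : Ultrafilter ℕ}
    {L : Measure ((ℕ → S) × (ℕ → T))} [IsProbabilityMeasure L] (hU : ↑U ≤ (atTop : Filter ℕ))
    (hlim : ∀ f : C((ℕ → S) × (ℕ → T), ℝ),
        Tendsto (fun l => ∫ ω, f (startedAt x l (fun i => N₀ i ω), fun i => N₀ i ω) ∂P₀) U
          (𝓝 (∫ p, f p ∂L))) :
    IsSolution μ L (fun k p => p.1 k) (fun k p => p.2 k) where
  measurable_state k := by fun_prop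
  measurable_noise k := by fun_prop
  equation k := by
    let := TopologicalSpace.metrizableSpaceMetric S
    have hcont : Continuous fun p : (ℕ → S) × (ℕ → T) => dist (p.1 k) (p.2 k • p.1 (k + 1)) :=
      Continuous.dist (by fun_prop) (Continuous.smul (by fun_prop) (by fun_prop))
    let g : C((ℕ → S) × (ℕ → T), ℝ) := ⟨_, hcont⟩
    have h0 : ∫ p, g p ∂L = 0 := by
      refine tendsto_nhds_unique (hlim g) (tendsto_const_nhds.congr' ?_)
      filter_upwards [hU (eventually_gt_atTop k)] with l hl
      symm
      refine (integral_congr_ae (ae_of_all _ fun ω => ?_)).trans (integral_zero' _ _)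
      simp only [g, ContinuousMap.coe_mk, Pi.zero_apply]
      rw [startedAt_eq_smul x _ hl, dist_self]
    have h1 := (integral_eq_zero_iff_of_nonneg (fun p => dist_nonneg)
      ((BoundedContinuousFunction.mkOfCompact g).integrable L)).1 h0
    filter_upwards [h1] with p hp
    exact dist_eq_zero.1 hp
  indep_past k := by
    refine (indep_past_iff (X := fun k (p : (ℕ → S) × (ℕ → T)) => p.1 k)
      (N := fun k p => p.2 k) k (k + 1)).2 ?_
    have hpc : Continuous (pastMap (fun k (p : (ℕ → S) × (ℕ → T)) => p.1 k)
        (fun k p => p.2 k) (k + 1)) := by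
      unfold pastMap
      fun_prop
    refine indepFun_of_bcf (by fun_prop) hpc.measurable.aemeasurable fun f g => ?_
    let f' : C((ℕ → S) × (ℕ → T), ℝ) := ⟨fun p => f (p.2 k), by fun_prop⟩
    let g' : C((ℕ → S) × (ℕ → T), ℝ) := ⟨_, g.continuous.comp hpc⟩
    have h1 := hlim (f' * g')
    have h2 := (hlim f').mul (hlim g')
    refine tendsto_nhds_unique (h1.congr fun l => ?_) h2
    have hi := (hN₀.indepFun_startedAt x l k).comp f.continuous.measurable g.continuous.measurable
    have hmp : Measurable fun ω => ((fun j => startedAt x l (fun i => N₀ i ω) (k + 1 + j)),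
        fun j => N₀ (k + 1 + j) ω) :=
      (continuous_startedAt_past x l (k + 1)).measurable.comp
        (measurable_pi_lambda _ hN₀.measurable_noise)
    exact hi.integral_mul_eq_mul_integral
      (f.continuous.measurable.comp (hN₀.measurable_noise k)).aestronglyMeasurable
      (g.continuous.measurable.comp hmp).aestronglyMeasurable
  law_noise k := by
    have hm : Measurable fun p : (ℕ → S) × (ℕ → T) => p.2 k := by fun_prop
    have := Measure.isProbabilityMeasure_map (μ := L) hm.aemeasurable
    have := Measure.isProbabilityMeasure_map (μ := P₀) (hN₀.measurable_noise k).aemeasurable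
    rw [← hN₀.law_noise k]
    refine ext_of_forall_integral_eq_of_IsFiniteMeasure fun f => ?_
    rw [integral_map hm.aemeasurable f.continuous.measurable.aestronglyMeasurable,
      integral_map (hN₀.measurable_noise k).aemeasurable
        f.continuous.measurable.aestronglyMeasurable]
    exact tendsto_nhds_unique (hlim ⟨fun p => f (p.2 k), by fun_prop⟩) tendsto_const_nhds

variable (hT : ∀ σ σ₁ σ₂ : T, σ * σ₁ = σ * σ₂ → σ₁ = σ₂)
  (hS : ∀ (σ : T) (x y : S), σ • x = σ • y → x = y)

include hN₀ hP2 hT hS in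
/-- In the weak limit, the tail values of the state lie in the orbit of the starting point. -/
theorem tendsto_integral_of_weak_limit {x : S} {U : Ultrafilter ℕ}
    {L : Measure ((ℕ → S) × (ℕ → T))} [IsProbabilityMeasure L] (hU : ↑U ≤ (atTop : Filter ℕ))
    (hlim : ∀ f : C((ℕ → S) × (ℕ → T), ℝ),
        Tendsto (fun l => ∫ ω, f (startedAt x l (fun i => N₀ i ω), fun i => N₀ i ω) ∂P₀) U
          (𝓝 (∫ p, f p ∂L)))
    (Φ : C(S, ℝ)) (hΦ : ∀ y ∈ (fun h : T => h • x) '' (H : Set T), Φ y = Φ x) :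
    Tendsto (fun m => ∫ p, Φ (p.1 (m + 1)) ∂L) atTop (𝓝 (Φ x)) := by
  -- For each m the process is started so early that its mean is within 1/(m + 1) of the weak limit.
  -- The number of factors thus varies with m, and the limits over m and over starting times need
  -- not be interchanged.
  have hr : ∀ m, ∃ r, dist (∫ ω, Φ (noiseProd N₀ (m + 1) r ω • x) ∂P₀)
      (∫ p, Φ (p.1 (m + 1)) ∂L) < 1 / ((m : ℝ) + 1) := by
    intro m
    have h1 := hlim ⟨fun p => Φ (p.1 (m + 1)), by fun_prop⟩
    have h2 := h1 (Metric.ball_mem_nhds _ (Nat.one_div_pos_of_nat (n := m)))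
    obtain ⟨l, hl, hl'⟩ := (Filter.Eventually.and (f := (U : Filter ℕ)) h2
      (hU (eventually_gt_atTop (m + 1)))).exists
    obtain ⟨r, rfl⟩ := Nat.exists_eq_add_of_lt hl'
    refine ⟨r, ?_⟩
    simp only [Metric.mem_ball, ContinuousMap.coe_mk, startedAt_add_succ] at hl
    simpa only [noiseProd_eq_pathProd] using hl
  choose r hr using hr
  have h1 : Tendsto (fun m => ∫ ω, Φ (noiseProd N₀ (m + 1) (r m) ω • x) ∂P₀) atTop
      (𝓝 (∫ _, Φ x ∂P₀)) := by
    refine tendsto_integral_of_dominated_convergence (fun _ => ‖Φ‖) (fun m => ?_)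
      (integrable_const _) (fun m => ae_of_all _ fun ω => Φ.norm_coe_le_norm _) ?_
    · exact (Φ.continuous.measurable.comp
        ((continuous_id.smul continuous_const).measurable.comp
          (measurable_noiseProd hN₀.measurable_noise _ _))).aestronglyMeasurable
    · filter_upwards [hP2.ae_cosetStable] with ω hω
      simp only [noiseProd_eq_pathProd]
      exact (hω.asympOrbit_pathProd hP2.isSubgroup hT hS r x).tendsto Φ.continuous hΦ
  simp only [integral_const, probReal_univ, one_smul] at h1
  refine (tendsto_iff_of_dist ?_).1 h1
  exact squeeze_zero (fun m => dist_nonneg) (fun m => (hr m).le)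
    tendsto_one_div_add_atTop_nhds_zero_nat

include hN₀ hP2 hT hS in
/-- For every `x` there is a solution whose states approach the orbit `Hx` in the remote past. -/
theorem exists_solutionLaw_asympOrbit (x : S) :
    ∃ L ∈ solutionLaws S μ, ∀ᵐ p ∂L, AsympOrbit H x fun n => p.1 n := by
  obtain ⟨U, L, hU, hLp, hlim⟩ := hN₀.exists_weak_limit x
  have hL := isSolution_of_weak_limit hN₀ hU hlim
  obtain ⟨Φ, hΦ⟩ := exists_continuousMap_separating_orbits (S := S) hP2.isCompact
    hP2.nontrivial.nonempty
  refine ⟨L, ⟨hLp, hL⟩, ?_⟩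
  have hdet : ∀ i, ∀ᵐ p ∂L, Tendsto (fun n => Φ i (p.1 n)) atTop (𝓝 (Φ i x)) := by
    intro i
    -- `D` vanishes on the orbit of `x`, so its mean along the states tends to 0. It also converges
    -- almost surely, the states approaching some random orbit, and a nonnegative limit of mean 0
    -- vanishes. The measurable limit `G` avoids a measurable choice of `y`.
    let D : C(S, ℝ) := ⟨fun y => |Φ i y - Φ i x|, by fun_prop⟩
    have h1 : Tendsto (fun m => ∫ p, D (p.1 (m + 1)) ∂L) atTop (𝓝 (D x)) := by
      refine tendsto_integral_of_weak_limit hN₀ hP2 hT hS hU hlim D fun y hy => ?_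
      simp only [D, ContinuousMap.coe_mk]
      rw [(hΦ y x).2 (orbit_eq_of_mem hP2.isSubgroup hT hy) i]
    have hconv : ∀ᵐ p ∂L, ∃ y, ∀ Ψ ∈ Set.range Φ ∪ {D},
        Tendsto (fun n => (Ψ : C(S, ℝ)) (p.1 n)) atTop (𝓝 (Ψ y)) := by
      filter_upwards [hL.ae_exists_asympOrbit hN₀ hP2 hT hS] with p hp
      obtain ⟨y, hy⟩ := hp
      refine ⟨y, ?_⟩
      rintro Ψ (⟨j, rfl⟩ | rfl)
      · exact hy.tendsto (Φ j).continuous fun z hz =>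
          (hΦ z y).2 (orbit_eq_of_mem hP2.isSubgroup hT hz) j
      · refine hy.tendsto D.continuous fun z hz => ?_
        simp only [D, ContinuousMap.coe_mk]
        rw [(hΦ z y).2 (orbit_eq_of_mem hP2.isSubgroup hT hz) i]
    have hmeas : ∀ n, Measurable fun p : (ℕ → S) × (ℕ → T) => D (p.1 (n + 1)) := fun n =>
      D.continuous.measurable.comp (by fun_prop)
    obtain ⟨G, hGm, hG⟩ := measurable_limit_of_tendsto_metrizable_ae (μ := L) (L := atTop)
      (f := fun n p => D (p.1 (n + 1))) (fun n => (hmeas n).aemeasurable) (by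
        filter_upwards [hconv] with p hp
        obtain ⟨y, hy⟩ := hp
        exact ⟨D y, (hy D (Or.inr rfl)).comp (tendsto_add_atTop_nat 1)⟩)
    have h2 : Tendsto (fun m => ∫ p, D (p.1 (m + 1)) ∂L) atTop (𝓝 (∫ p, G p ∂L)) :=
      tendsto_integral_of_dominated_convergence (fun _ => ‖D‖)
        (fun n => (hmeas n).aestronglyMeasurable) (integrable_const _)
        (fun n => ae_of_all _ fun p => D.norm_coe_le_norm _) hG
    have hD0 : D x = 0 := by simp [D]
    have hGi : ∫ p, G p ∂L = 0 := by rw [tendsto_nhds_unique h2 h1, hD0]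
    have hGb : ∀ᵐ p ∂L, 0 ≤ G p ∧ ‖G p‖ ≤ ‖D‖ := by
      filter_upwards [hG] with p hp
      exact ⟨ge_of_tendsto' hp fun n => abs_nonneg _,
        le_of_tendsto' hp.norm fun n => D.norm_coe_le_norm _⟩
    have hG0 := (integral_eq_zero_iff_of_nonneg_ae (hGb.mono fun p hp => hp.1)
      (Integrable.of_bound hGm.aestronglyMeasurable ‖D‖ (hGb.mono fun p hp => hp.2))).1 hGi
    filter_upwards [hG, hG0, hconv] with p hp hp0 ⟨y, hy⟩
    have h3 : D y = 0 := by
      rw [hp0] at hp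
      exact tendsto_nhds_unique ((hy D (Or.inr rfl)).comp (tendsto_add_atTop_nat 1)) hp
    have h4 : Φ i y = Φ i x := sub_eq_zero.1 (abs_eq_zero.1 h3)
    rw [← h4]
    exact hy _ (Or.inl ⟨i, rfl⟩)
  filter_upwards [ae_all_iff.2 hdet] with p hp
  exact (asympOrbit_iff_tendsto hP2.isSubgroup hT hS hΦ).2 hp

end Existence

/-! ### Extremal laws, tail triviality, and dependence of strength on the law alone -/

section Extremal

variable {S T : Type*} [MeasurableSpace S] [MeasurableSpace T] [SMul T S] {μ : ℕ → Measure T}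

/-- Conditioning the law of a solution on a tail event gives the law of a solution. -/
theorem cond_mem_solutionLaws {L : Measure ((ℕ → S) × (ℕ → T))} (hL : L ∈ solutionLaws S μ)
    {A : Set ((ℕ → S) × (ℕ → T))} (hA : MeasurableSet A)
    (htail : ∀ k, pastMap (fun k (p : (ℕ → S) × (ℕ → T)) => p.1 k) (fun k p => p.2 k) k ⁻¹' A = A)
    (h0 : L A ≠ 0) : L[|A] ∈ solutionLaws S μ := by
  obtain ⟨hp, h⟩ := hL
  have hpA : IsProbabilityMeasure L[|A] := cond_isProbabilityMeasure h0
  have hmp : ∀ k, Measurable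
      (pastMap (fun k (p : (ℕ → S) × (ℕ → T)) => p.1 k) (fun k p => p.2 k) k) :=
    measurable_pastMap h.measurable_state h.measurable_noise
  have key : ∀ k (B : Set T), MeasurableSet B → ∀ C : Set ((ℕ → S) × (ℕ → T)), MeasurableSet C →
      L[|A] ((fun p : (ℕ → S) × (ℕ → T) => p.2 k) ⁻¹' B ∩
        pastMap (fun k (p : (ℕ → S) × (ℕ → T)) => p.1 k) (fun k p => p.2 k) (k + 1) ⁻¹' C) =
      μ k B * L[|A]
        (pastMap (fun k (p : (ℕ → S) × (ℕ → T)) => p.1 k) (fun k p => p.2 k) (k + 1) ⁻¹' C) := by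
    intro k B hB C hC
    -- Shift invariance places `A` in the past of every time, so `A ∩ C` is an admissible past event
    -- and conditioning on `A` does not affect the noise.
    have h1 := (h.indepFun_pastMap k).measure_inter_preimage_eq_mul _ _ hB (hA.inter hC)
    rw [Set.preimage_inter, htail] at h1
    rw [cond_apply hA, cond_apply hA, Set.inter_left_comm, h1, ← h.law_noise k,
      Measure.map_apply (h.measurable_noise k) hB]
    ring
  have hlaw : ∀ k, L[|A].map (fun p => p.2 k) = μ k := by
    intro k
    ext B hB
    have h1 := key k B hB Set.univ MeasurableSet.univ
    rw [Set.preimage_univ, Set.inter_univ, measure_univ, mul_one] at h1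
    rw [Measure.map_apply (h.measurable_noise k) hB, h1]
  refine ⟨hpA, h.measurable_state, h.measurable_noise, fun k => ?_, fun k => ?_, hlaw⟩
  · exact cond_absolutelyContinuous.ae_le (h.equation k)
  · refine (indep_past_iff (X := fun k (p : (ℕ → S) × (ℕ → T)) => p.1 k)
      (N := fun k p => p.2 k) k (k + 1)).2 ?_
    rw [indepFun_iff_measure_inter_preimage_eq_mul]
    intro B C hB hC
    rw [key k B hB C hC, ← hlaw k, Measure.map_apply (h.measurable_noise k) hB]

/-- Tail events are trivial under an extremal law. -/
theorem measure_eq_zero_or_of_mem_extremePoints {L : Measure ((ℕ → S) × (ℕ → T))}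
    (hL : L ∈ Set.extremePoints ℝ≥0 (solutionLaws S μ)) {A : Set ((ℕ → S) × (ℕ → T))}
    (hA : MeasurableSet A)
    (htail : ∀ k, pastMap (fun k (p : (ℕ → S) × (ℕ → T)) => p.1 k) (fun k p => p.2 k) k ⁻¹' A = A) :
    L A = 0 ∨ L Aᶜ = 0 := by
  by_contra! hne
  obtain ⟨h1, h2⟩ := hne
  have hp : IsProbabilityMeasure L := hL.1.1
  have hc1 := cond_mem_solutionLaws hL.1 hA htail h1
  have hc2 := cond_mem_solutionLaws hL.1 hA.compl
    (fun k => by rw [Set.preimage_compl, htail]) h2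
  have hseg : L ∈ openSegment ℝ≥0 (L[|A]) (L[|Aᶜ]) := by
    refine ⟨(L A).toNNReal, (L Aᶜ).toNNReal, ENNReal.toNNReal_pos h1 (measure_ne_top _ _),
      ENNReal.toNNReal_pos h2 (measure_ne_top _ _), ?_, ?_⟩
    · rw [← ENNReal.toNNReal_add (measure_ne_top _ _) (measure_ne_top _ _),
        measure_add_measure_compl hA, measure_univ, ENNReal.toNNReal_one]
    · ext B hB
      rw [Measure.add_apply, Measure.smul_apply, Measure.smul_apply, ENNReal.smul_def,
        ENNReal.smul_def, ENNReal.coe_toNNReal (measure_ne_top _ _),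
        ENNReal.coe_toNNReal (measure_ne_top _ _), smul_eq_mul, smul_eq_mul, cond_apply hA,
        cond_apply hA.compl, ← mul_assoc, ← mul_assoc,
        ENNReal.mul_inv_cancel h1 (measure_ne_top _ _),
        ENNReal.mul_inv_cancel h2 (measure_ne_top _ _), one_mul, one_mul, Set.inter_comm,
        Set.inter_comm Aᶜ, ← Set.sdiff_eq, measure_inter_add_sdiff _ hA]
  have heq := hL.2 hc1 hc2 hseg
  refine h2 ?_
  rw [← heq, cond_apply hA, Set.inter_compl_self, measure_empty, mul_zero]

theorem ae_left_of_smul_add_smul_eq {α : Type*} [MeasurableSpace α] {L L₁ L₂ : Measure α}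
    {a b : ℝ≥0} (ha : 0 < a) (h : a • L₁ + b • L₂ = L) {p : α → Prop} (hp : ∀ᵐ x ∂L, p x) :
    ∀ᵐ x ∂L₁, p x := by
  rw [ae_iff] at hp ⊢
  rw [← h, Measure.add_apply, add_eq_zero, Measure.smul_apply, ENNReal.smul_def, smul_eq_mul,
    mul_eq_zero] at hp
  exact hp.1.resolve_left (by exact_mod_cast ha.ne')

/-- Strength of a solution only depends on its law. -/
theorem isStrong_map_iff [MeasurableEq S] {Ω Ω' : Type*} [MeasurableSpace Ω] [MeasurableSpace Ω']
    {P : Measure Ω'} {g : Ω' → Ω} (hg : Measurable g) {X : ℕ → Ω → S} {N : ℕ → Ω → T}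
    (hX : ∀ k, Measurable (X k)) (hN : ∀ k, Measurable (N k)) :
    IsStrong (P.map g) X N ↔ IsStrong P (fun k => X k ∘ g) (fun k => N k ∘ g) := by
  refine forall_congr' fun k => exists_congr fun f => and_congr_right fun hf => ?_
  exact ae_map_iff hg.aemeasurable (p := fun ω => X k ω = f fun j => N (k + j) ω)
    (measurableSet_eq_fun (hX k) (hf.comp (measurable_pi_lambda _ fun j => hN _)))

theorem IsSolution.isStrong_iff [MeasurableEq S] {Ω : Type*} [MeasurableSpace Ω] {P : Measure Ω}
    {X : ℕ → Ω → S} {N : ℕ → Ω → T} (h : IsSolution μ P X N) :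
    IsStrong P X N ↔ IsStrong (P.map fun ω => ((fun k => X k ω), (fun k => N k ω)))
      (fun k p => p.1 k) (fun k p => p.2 k) := by
  have hm : Measurable fun ω => ((fun k => X k ω), (fun k => N k ω)) :=
    (measurable_pi_lambda _ h.measurable_state).prodMk (measurable_pi_lambda _ h.measurable_noise)
  rw [isStrong_map_iff hm (by fun_prop) (by fun_prop)]
  rfl

/-- Every law of solutions is realized on a probability space in any given universe. -/
theorem exists_isSolution_of_mem_solutionLaws [StandardBorelSpace S] [StandardBorelSpace T]
    {L : Measure ((ℕ → S) × (ℕ → T))} (hL : L ∈ solutionLaws S μ) :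
    ∃ (Ω : Type w) (_ : MeasurableSpace Ω) (P : Measure Ω) (_ : IsProbabilityMeasure P)
      (X : ℕ → Ω → S) (N : ℕ → Ω → T), IsSolution μ P X N ∧
        P.map (fun ω => ((fun k => X k ω), (fun k => N k ω))) = L := by
  obtain ⟨hp, h⟩ := hL
  have hne : Nonempty ((ℕ → S) × (ℕ → T)) := L.nonempty_of_neZero
  -- A Borel embedding of the standard Borel path space into ℝ, followed by a lift of ℝ, realizes
  -- the law in the prescribed universe.
  have he := measurableEmbedding_embeddingReal ((ℕ → S) × (ℕ → T))
  let i : (ℕ → S) × (ℕ → T) → ULift.{w} ℝ := fun p => ULift.up (embeddingReal _ p)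
  have hi : Measurable i := measurable_up.comp he.measurable
  let g : ULift.{w} ℝ → (ℕ → S) × (ℕ → T) := fun r => he.invFun r.down
  have hg : Measurable g := he.measurable_invFun.comp measurable_down
  have hgi : g ∘ i = id := funext fun p => he.leftInverse_invFun p
  have hmap : (L.map i).map g = L := by rw [Measure.map_map hg hi, hgi, Measure.map_id]
  refine ⟨ULift.{w} ℝ, inferInstance, L.map i, Measure.isProbabilityMeasure_map hi.aemeasurable,
    fun k r => (g r).1 k, fun k r => (g r).2 k, ?_, hmap⟩
  exact IsSolution.comp hg (by rw [hmap]; exact h)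

end Extremal

/-! ### Which solutions are extremal, and which are strong -/

section Strength

variable {S T : Type*} [TopologicalSpace S] [CompactSpace S] [TopologicalSpace.MetrizableSpace S]
  [SecondCountableTopology S] [MeasurableSpace S] [BorelSpace S] [TopologicalSpace T]
  [CompactSpace T] [TopologicalSpace.MetrizableSpace T] [SecondCountableTopology T]
  [MeasurableSpace T] [BorelSpace T] [Semigroup T] [ContinuousMul T] [SemigroupAction T S]
  [ContinuousSMul T S] {μ : ℕ → Measure T} {H : Subsemigroup T}
  {Ω₀ : Type*} [MeasurableSpace Ω₀] {P₀ : Measure Ω₀} [IsProbabilityMeasure P₀]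
  {N₀ : ℕ → Ω₀ → T} (hN₀ : IsNoise μ P₀ N₀) (hP2 : SatisfiesP2 P₀ N₀ H)
  (hT : ∀ σ σ₁ σ₂ : T, σ * σ₁ = σ * σ₂ → σ₁ = σ₂)
  (hS : ∀ (σ : T) (x y : S), σ • x = σ • y → x = y)

theorem map_coordinates (L : Measure ((ℕ → S) × (ℕ → T))) :
    L.map (fun p => ((fun k => p.1 k), (fun k => p.2 k))) = L :=
  Measure.map_id

include hN₀ hP2 in
-- A component of a convex decomposition inherits the almost sure asymptotic orbit, and this orbit
-- determines the law.
theorem mem_extremePoints_of_asympOrbit {L : Measure ((ℕ → S) × (ℕ → T))}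
    (hL : L ∈ solutionLaws S μ) {x : S} (hx : ∀ᵐ p ∂L, AsympOrbit H x fun n => p.1 n) :
    L ∈ Set.extremePoints ℝ≥0 (solutionLaws S μ) := by
  refine mem_extremePoints_iff_left.2 ⟨hL, fun L₁ hL₁ L₂ hL₂ ⟨a, b, ha, hb, hab, h⟩ => ?_⟩
  have h1 := ae_left_of_smul_add_smul_eq ha h hx
  have := hL.1
  have := hL₁.1
  have h2 := hL₁.2.map_eq_of_asympOrbit hN₀ hP2 hL.2 h1 hx
  rwa [map_coordinates, map_coordinates] at h2

/-- A component inherits the almost sure formulas for the states in terms of the noise. As the law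
of the noise is the same for all solutions, the component is the same image of it. -/
theorem mem_extremePoints_of_isStrong {L : Measure ((ℕ → S) × (ℕ → T))}
    (hL : L ∈ solutionLaws S μ) (hs : IsStrong L (fun k p => p.1 k) (fun k p => p.2 k)) :
    L ∈ Set.extremePoints ℝ≥0 (solutionLaws S μ) := by
  refine mem_extremePoints_iff_left.2 ⟨hL, fun L₁ hL₁ L₂ hL₂ ⟨a, b, ha, hb, hab, h⟩ => ?_⟩
  choose f hf hfe using hs
  have hall := ae_all_iff.2 hfe
  have hall₁ := ae_left_of_smul_add_smul_eq ha h hall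
  let G : (ℕ → T) → (ℕ → S) × (ℕ → T) := fun t => (fun k => f k fun j => t (k + j), t)
  have hG : Measurable G :=
    (measurable_pi_lambda _ fun k => (hf k).comp (by fun_prop)).prodMk measurable_id
  have key : ∀ L' : Measure ((ℕ → S) × (ℕ → T)),
      (∀ᵐ p ∂L', ∀ k, p.1 k = f k fun j => p.2 (k + j)) → L' = (L'.map Prod.snd).map G := by
    intro L' h'
    rw [Measure.map_map hG measurable_snd]
    conv_lhs => rw [← Measure.map_id (μ := L')]
    refine Measure.map_congr ?_
    filter_upwards [h'] with p hp
    exact Prod.ext (funext hp) rfl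
  have := hL.1
  have := hL₁.1
  have h2 : L₁.map Prod.snd = L.map Prod.snd := hL₁.2.map_noise_eq hL.2
  rw [key L₁ hall₁, key L hall, h2]

include hN₀ hP2 hT hS in
/-- Under an extremal law, the asymptotic orbit in the remote past is deterministic. -/
theorem exists_asympOrbit_of_mem_extremePoints {L : Measure ((ℕ → S) × (ℕ → T))}
    (hL : L ∈ Set.extremePoints ℝ≥0 (solutionLaws S μ)) :
    ∃ x : S, ∀ᵐ p ∂L, AsympOrbit H x fun n => p.1 n := by
  have hp : IsProbabilityMeasure L := hL.1.1
  obtain ⟨Φ, hΦ⟩ := exists_continuousMap_separating_orbits (S := S) hP2.isCompact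
    hP2.nontrivial.nonempty
  -- The upper limits are defined on every path, measurable and exactly shift invariant, and almost
  -- surely equal the values of Φ on the asymptotic orbit. Tail triviality makes them constant.
  let Z : (ℕ → S) × (ℕ → T) → ℕ → ℝ := fun p i => limsup (fun n => Φ i (p.1 n)) atTop
  have hZ : Measurable Z := measurable_pi_lambda _ fun i => Measurable.limsup fun n =>
    (Φ i).continuous.measurable.comp (by fun_prop)
  have htail : ∀ k p,
      Z (pastMap (fun k (p : (ℕ → S) × (ℕ → T)) => p.1 k) (fun k p => p.2 k) k p) = Z p := by
    intro k p
    funext i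
    simp only [Z, pastMap, add_comm k]
    exact limsup_nat_add (fun n => Φ i (p.1 n)) k
  obtain ⟨z, hz⟩ := exists_eventuallyEq_const_of_forall_separating (l := ae L) (f := Z)
    MeasurableSet fun B hB => by
      have h1 := measure_eq_zero_or_of_mem_extremePoints hL (hZ hB) fun k => by
        ext p
        simp only [Set.mem_preimage, htail]
      rcases h1 with h1 | h1
      · exact Or.inr (measure_eq_zero_iff_ae_notMem.1 h1)
      · exact Or.inl (mem_ae_iff.2 h1)
  have hlim : ∀ᵐ p ∂L, ∃ y, (∀ i, Tendsto (fun n => Φ i (p.1 n)) atTop (𝓝 (Φ i y))) ∧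
      ∀ i, Φ i y = z i := by
    filter_upwards [hz, hL.1.2.ae_exists_asympOrbit hN₀ hP2 hT hS] with p hp ⟨y, hy⟩
    have h1 := (asympOrbit_iff_tendsto hP2.isSubgroup hT hS hΦ).1 hy
    exact ⟨y, h1, fun i => (h1 i).limsup_eq.symm.trans (congrFun hp i)⟩
  obtain ⟨p, x, -, hx⟩ := hlim.exists
  refine ⟨x, ?_⟩
  filter_upwards [hlim] with p ⟨y, hy, hyz⟩
  refine (asympOrbit_iff_tendsto hP2.isSubgroup hT hS hΦ).2 fun i => ?_
  rw [hx i, ← hyz i]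
  exact hy i

/-- If the asymptotic orbit is a single point, then the solution is strong. -/
theorem isStrong_of_asympOrbit {L : Measure ((ℕ → S) × (ℕ → T))} (hL : L ∈ solutionLaws S μ)
    {x : S} (hx : ∀ᵐ p ∂L, AsympOrbit H x fun n => p.1 n) (hfix : ∀ h ∈ H, h • x = x) :
    IsStrong L (fun k p => p.1 k) (fun k p => p.2 k) := by
  intro k
  have : PolishSpace S := by
    let := TopologicalSpace.metrizableSpaceMetric S
    infer_instance
  have hshift : Measurable fun (p : (ℕ → S) × (ℕ → T)) (j : ℕ) => p.2 (k + j) := by fun_prop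
  -- The noise products themselves may fail to converge; along each ultrafilter the earlier states
  -- tend to the fixed point `x`, so every limit point σ of the products satisfies σx = X_k.
  have hlim : ∀ᵐ p ∂L,
      Tendsto (fun n => pathProd (fun j => p.2 (k + j)) 0 n • x) atTop (𝓝 (p.1 k)) := by
    filter_upwards [hx, hL.2.ae_equation] with p hp heq
    rw [tendsto_iff_ultrafilter]
    intro U hU
    obtain ⟨σ, hσ⟩ := U.exists_tendsto_of_compactSpace fun n => pathProd (fun j => p.2 (k + j)) 0 n
    obtain ⟨y, hy⟩ := U.exists_tendsto_of_compactSpace fun n => p.1 (k + n + 1)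
    have hs : Tendsto (fun n => k + n + 1) atTop atTop :=
      tendsto_atTop_mono (fun n => by simp only [id]; lia) tendsto_id
    obtain ⟨h, hh, rfl⟩ := hp (U.map fun n => k + n + 1) (hs.mono_left hU) y
      (by rw [Ultrafilter.coe_map, tendsto_map'_iff]; exact hy)
    simp only [hfix h hh] at hy
    have h1 : p.1 k = σ • x := by
      refine tendsto_nhds_unique (tendsto_const_nhds.congr fun n => ?_) (hσ.smul hy)
      rw [← pathProd_shift]
      exact eq_pathProd_smul heq k n
    rw [h1]
    exact hσ.smul tendsto_const_nhds
  have hmeas : ∀ n, Measurable fun t : ℕ → T => pathProd t 0 n • x := fun n =>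
    ((continuous_pathProd 0 n).smul continuous_const).measurable
  obtain ⟨f, hf, hfe⟩ := measurable_limit_of_tendsto_metrizable_ae
    (μ := L.map fun (p : (ℕ → S) × (ℕ → T)) (j : ℕ) => p.2 (k + j)) (L := atTop)
    (f := fun n t => pathProd t 0 n • x) (fun n => (hmeas n).aemeasurable) (by
      refine (ae_map_iff hshift.aemeasurable (measurableSet_exists_tendsto hmeas)).2 ?_
      filter_upwards [hlim] with p hp
      exact ⟨_, hp⟩)
  refine ⟨f, hf, ?_⟩
  filter_upwards [hlim, ae_of_ae_map hshift.aemeasurable hfe] with p h1 h2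
  exact tendsto_nhds_unique h1 h2

/-- The diagonal action of a semigroup on pairs. -/
@[reducible]
def diagonalAction (T S : Type*) [Semigroup T] [SemigroupAction T S] :
    SemigroupAction T (S × S) where
  mul_smul σ τ p := Prod.ext (mul_smul σ τ p.1) (mul_smul σ τ p.2)

include hN₀ hP2 hT hS in
/-- If the asymptotic orbit is not a single point, then the solution is not strong. -/
theorem not_isStrong_of_asympOrbit {L : Measure ((ℕ → S) × (ℕ → T))} (hL : L ∈ solutionLaws S μ)
    {x : S} (hx : ∀ᵐ p ∂L, AsympOrbit H x fun n => p.1 n) {h : T} (hh : h ∈ H)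
    (hne : h • x ≠ x) : ¬ IsStrong L (fun k p => p.1 k) (fun k p => p.2 k) := by
  intro hs
  have := hL.1
  let := diagonalAction T S
  -- This couples two solutions with the same noise, jointly approaching the orbit of (x, hx).
  obtain ⟨L', hL', hx'⟩ := exists_solutionLaw_asympOrbit (S := S × S) hN₀ hP2 hT
    (fun σ p q hpq => Prod.ext (hS σ _ _ (congrArg Prod.fst hpq))
      (hS σ _ _ (congrArg Prod.snd hpq))) (x, h • x)
  have := hL'.1
  have h1 : IsSolution μ L' (fun k p => (p.1 k).1) (fun k p => p.2 k) :=
    hL'.2.map_state measurable_fst fun _ _ => rfl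
  have h2 : IsSolution μ L' (fun k p => (p.1 k).2) (fun k p => p.2 k) :=
    hL'.2.map_state measurable_snd fun _ _ => rfl
  have hx1 : ∀ᵐ p ∂L', AsympOrbit H x fun n => (p.1 n).1 := by
    filter_upwards [hx'] with p hp U hU y hy
    obtain ⟨y', hy'⟩ := U.exists_tendsto_of_compactSpace fun n => (p.1 n).2
    obtain ⟨g, hg, hge⟩ := hp U hU (y, y') (hy.prodMk_nhds hy')
    exact ⟨g, hg, congrArg Prod.fst hge⟩
  have hx2 : ∀ᵐ p ∂L', AsympOrbit H x fun n => (p.1 n).2 := by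
    filter_upwards [hx'] with p hp U hU y hy
    obtain ⟨y', hy'⟩ := U.exists_tendsto_of_compactSpace fun n => (p.1 n).1
    obtain ⟨g, hg, hge⟩ := hp U hU (y', y) (hy'.prodMk_nhds hy)
    exact ⟨g * h, H.mul_mem hg hh, (mul_smul g h x).trans (congrArg Prod.snd hge)⟩
  -- Each coordinate approaches Hx, so both have the law `L` and are given by the same functions `f`
  -- of the common noise.
  have e1 := h1.map_eq_of_asympOrbit hN₀ hP2 hL.2 hx1 hx
  have e2 := h2.map_eq_of_asympOrbit hN₀ hP2 hL.2 hx2 hx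
  rw [map_coordinates] at e1 e2
  choose f hf hfe using hs
  have hmeas : ∀ k, MeasurableSet {p : (ℕ → S) × (ℕ → T) | p.1 k = f k fun j => p.2 (k + j)} :=
    fun k => measurableSet_eq_fun (by fun_prop) ((hf k).comp (by fun_prop))
  have s1 : ∀ᵐ p ∂L', ∀ k, (p.1 k).1 = f k fun j => p.2 (k + j) := by
    refine ae_all_iff.2 fun k => ?_
    have := hfe k
    rw [← e1] at this
    exact ae_of_ae_map (by fun_prop) this
  have s2 : ∀ᵐ p ∂L', ∀ k, (p.1 k).2 = f k fun j => p.2 (k + j) := by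
    refine ae_all_iff.2 fun k => ?_
    have := hfe k
    rw [← e2] at this
    exact ae_of_ae_map (by fun_prop) this
  obtain ⟨p, hp, hp1, hp2⟩ := (hx'.and (s1.and s2)).exists
  obtain ⟨y, hy⟩ := (Ultrafilter.of (atTop : Filter ℕ)).exists_tendsto_of_compactSpace
    fun n => (p.1 n).1
  have hy' : Tendsto (fun n => (p.1 n).2) (Ultrafilter.of (atTop : Filter ℕ)) (𝓝 y) :=
    hy.congr fun n => by rw [hp1, hp2]
  -- A limit point on the diagonal means gx = ghx; cancelling g contradicts hx ≠ x.
  obtain ⟨g, hg, hge⟩ := hp _ (Ultrafilter.of_le _) (y, y) (hy.prodMk_nhds hy')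
  exact hne (hS g _ _ ((congrArg Prod.snd hge).trans (congrArg Prod.fst hge).symm))

end Strength

/-! ### The three equivalences -/

theorem mainTheorem4
    {S : Type*} [TopologicalSpace S] [CompactSpace S] [TopologicalSpace.MetrizableSpace S]
    [MeasurableSpace S] [BorelSpace S]
    {T : Type*} [TopologicalSpace T] [CompactSpace T] [TopologicalSpace.MetrizableSpace T]
    [MeasurableSpace T] [BorelSpace T]
    [Semigroup T] [ContinuousMul T] [SemigroupAction T S] [ContinuousSMul T S]
    -- the noise law, and a noise process with this law
    (μ : ℕ → Measure T) [∀ k, IsProbabilityMeasure (μ k)]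
    {Ω₀ : Type*} [MeasurableSpace Ω₀] (P₀ : Measure Ω₀) [IsProbabilityMeasure P₀]
    (N₀ : ℕ → Ω₀ → T) (hN₀ : IsNoise μ P₀ N₀)
    (H : Subsemigroup T) (hP2 : SatisfiesP2 P₀ N₀ H)
    -- left-cancellativity of the semigroup and cancellativity of the action
    (hT : ∀ σ σ₁ σ₂ : T, σ * σ₁ = σ * σ₂ → σ₁ = σ₂)
    (hS : ∀ (σ : T) (x y : S), σ • x = σ • y → x = y) :
    -- (i)
    ((∀ x : S, OrbitIsSingleton H x) ↔
      ∀ (Ω : Type w) [MeasurableSpace Ω] (P : Measure Ω) [IsProbabilityMeasure P]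
        (X : ℕ → Ω → S) (N : ℕ → Ω → T),
        IsSolution μ P X N → IsExtremal μ P X N → IsStrong P X N) ∧
    -- (ii)
    ((∀ x : S, ¬ OrbitIsSingleton H x) ↔
      ∀ (Ω : Type w) [MeasurableSpace Ω] (P : Measure Ω) [IsProbabilityMeasure P]
        (X : ℕ → Ω → S) (N : ℕ → Ω → T),
        IsSolution μ P X N → IsExtremal μ P X N → ¬ IsStrong P X N) ∧
    -- (iii)
    ((∀ x : S, ¬ OrbitIsSingleton H x) ↔
      ∀ (Ω : Type w) [MeasurableSpace Ω] (P : Measure Ω) [IsProbabilityMeasure P]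
        (X : ℕ → Ω → S) (N : ℕ → Ω → T),
        IsSolution μ P X N → ¬ IsStrong P X N) := by
  have : SecondCountableTopology S := by
    let := TopologicalSpace.metrizableSpaceMetric S
    infer_instance
  have : SecondCountableTopology T := by
    let := TopologicalSpace.metrizableSpaceMetric T
    infer_instance
  have : PolishSpace S := by
    let := TopologicalSpace.metrizableSpaceMetric S
    infer_instance
  have : PolishSpace T := by
    let := TopologicalSpace.metrizableSpaceMetric T
    infer_instance
  have strong_iff : ∀ {L : Measure ((ℕ → S) × (ℕ → T))}, L ∈ solutionLaws S μ → ∀ {x : S},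
      (∀ᵐ p ∂L, AsympOrbit H x fun n => p.1 n) →
        (IsStrong L (fun k p => p.1 k) (fun k p => p.2 k) ↔ OrbitIsSingleton H x) := by
    intro L hL x hx
    rw [orbitIsSingleton_iff hP2.isSubgroup hT hS]
    refine ⟨fun hs h hh => ?_, isStrong_of_asympOrbit hL hx⟩
    by_contra hne
    exact not_isStrong_of_asympOrbit hN₀ hP2 hT hS hL hx hh hne hs
  have of_extremal : ∀ {Ω : Type w} [MeasurableSpace Ω] {P : Measure Ω} [IsProbabilityMeasure P]
      {X : ℕ → Ω → S} {N : ℕ → Ω → T}, IsSolution μ P X N → IsExtremal μ P X N →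
        ∃ x : S, IsStrong P X N ↔ OrbitIsSingleton H x := by
    intro Ω _ P _ X N h he
    obtain ⟨x, hx⟩ := exists_asympOrbit_of_mem_extremePoints hN₀ hP2 hT hS he
    exact ⟨x, h.isStrong_iff.trans (strong_iff he.1 hx)⟩
  have of_point : ∀ x : S, ∃ (Ω : Type w) (_ : MeasurableSpace Ω) (P : Measure Ω)
      (_ : IsProbabilityMeasure P) (X : ℕ → Ω → S) (N : ℕ → Ω → T), IsSolution μ P X N ∧
        IsExtremal μ P X N ∧ (IsStrong P X N ↔ OrbitIsSingleton H x) := by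
    intro x
    obtain ⟨L, hL, hx⟩ := exists_solutionLaw_asympOrbit hN₀ hP2 hT hS x
    obtain ⟨Ω, m, P, hP, X, N, h, hmap⟩ := exists_isSolution_of_mem_solutionLaws.{w} hL
    refine ⟨Ω, m, P, hP, X, N, h, ?_, ?_⟩
    · rw [IsExtremal, hmap]
      exact mem_extremePoints_of_asympOrbit hN₀ hP2 hL hx
    · rw [h.isStrong_iff, hmap]
      exact strong_iff hL hx
  refine ⟨⟨fun hs Ω _ P _ X N h he => ?_, fun hs x => ?_⟩,
    ⟨fun hs Ω _ P _ X N h he => ?_, fun hs x => ?_⟩, ⟨fun hs Ω _ P _ X N h => ?_, fun hs x => ?_⟩⟩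
  · obtain ⟨x, hx⟩ := of_extremal h he
    exact hx.2 (hs x)
  · obtain ⟨Ω, m, P, hP, X, N, h, he, hx⟩ := of_point x
    exact hx.1 (hs Ω P X N h he)
  · obtain ⟨x, hx⟩ := of_extremal h he
    exact fun h' => hs x (hx.1 h')
  · obtain ⟨Ω, m, P, hP, X, N, h, he, hx⟩ := of_point x
    exact fun h' => hs Ω P X N h he (hx.2 h')
  · intro h'
    have he : IsExtremal μ P X N :=
      mem_extremePoints_of_isStrong h.map_mem_solutionLaws (h.isStrong_iff.1 h')
    obtain ⟨x, hx⟩ := of_extremal h he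
    exact hs x (hx.1 h')
  · obtain ⟨Ω, m, P, hP, X, N, h, he, hx⟩ := of_point x
    exact fun h' => hs Ω P X N h (hx.2 h')
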